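/- Let $F_0$ be a field of characteristic $0$ with an automorphism $\sigma$ and constant field $C=\{c\in F_0\mid\sigma(c)=c\}$, and let $F_n=F_0(t_1,\dots,t_n)$ be a tower of $\Sigma^*$-extensions of $(F_0,\sigma)$: with $F_i=F_0(t_1,\dots,t_i)$, each $t_i$ is transcendental over $F_{i-1}$, $\sigma$ is extended to an automorphism of $F_n$ with $\Delta(t_i)\in F_{i-1}$, where $\Delta(f)=\sigma(f)-f$, and every $f\in F_n$ with $\sigma(f)=f$ lies in $C$. Assume moreover that $\Delta(t_i)\in E_{i-1}$ for $1\le i\le n$, where $E_i=F_0[t_1,\dots,t_i]$ (so that the $E_i$ form a tower of polynomial $\Sigma^*$-ring extensions). For a $C$-space $V$ and a subspace $U$, a $C$-linear map $\phi:V\to V$ is a complete reduction for $U$ if $f-\phi(f)\in U$ for all $f\in V$ and $\ker\phi=U$. Let $\phi_0$ be a complete reduction for $\Delta(F_0)$ on $F_0$ and let $\Theta_0$ be a $C$-basis of $F_0$. For each $i$ with $1\le i\le n$ let $S_i$ be a set of representatives of the monic irreducible polynomials in $F_{i-1}[t_i]$ with respect to the equivalence $p\sim q:\Leftrightarrow p=c\,\sigma^{\ell}(q)$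 for some $c\in F_{i-1}\setminus\{0\}$, $\ell\in\mathbb Z$. The $\Theta_0$-canonical basis $\Xi_i$ of $F_i$ consists of the products $\theta_0\theta_1\cdots\theta_i$ with $\theta_0\in\Theta_0$ and, for $1\le j\le i$, $\theta_j$ of the form $t_j^k$ $(k\ge0)$ or $t_j^k/q^m$ ($q\in F_{j-1}[t_j]$ monic irreducible, $0\le k<\deg q$, $m\ge1$). For $\theta\in\Xi_i$ let $\theta^*:F_i\to C$ be the corresponding coordinate functional. The indicator of $f\in F_n$ is the least $i$ with $f\in F_i$. Define $C$-linear maps $\phi_i:F_i\to F_i$ recursively: for $1\le i\le n$ choose $\theta_i\in\Xi_{i-1}$ with $\theta_i^*(\phi_{i-1}(\Delta(t_i)))\ne0$ whose indicator equals that of $\phi_{i-1}(\Delta(t_i))$, and let $\phi_i$ be the projection of $F_i$ onto $U_{S_i}\oplus V_{\theta_i}$ along $\Delta(F_i)$, where $U_{S_i}$ is the space of rational functions $a/b$ with $a,b\in F_{i-1}[t_i]$, $\deg a<\deg b$ and $b$ a product of elements of $S_i$, and $V_{\theta_i}=\bigoplus_{k\ge0}(\operatorname{im}\phi_{i-1}\cap\ker\theta_i^*)\,t_i^k$.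 Then such choices of $\theta_1,\dots,\theta_n$ exist. Moreover, for every such choice, the following holds. (1) $F_i=\Delta(F_i)\oplus(U_{S_i}\oplus V_{\theta_i})$ for $1\le i\le n$, and for $0\le i\le n$ we have $\Delta(F_i)\subseteq F_i$ and $\phi_i$ is a complete reduction for $\Delta(F_i)$ on $F_i$. (2) For $0\le i\le n$, $\Delta(E_i)\subseteq E_i$, $\phi_i$ maps $E_i$ into $E_i$, and $\phi_i|_{E_i}$ is a complete reduction for $\Delta(E_i)$ on $E_i$. (3) Suppose that $(F_0,\sigma)$ is computable (the elements of $F_0$ are coded so that the field operations, equality and $\sigma$ are computable), that $\Theta_0$ is effective (one can compute, for $a\in F_0\setminus\{0\}$, some $\theta\in\Theta_0$ with $\theta^*(a)\ne0$, and, for $\theta\in\Theta_0$ and $a\in F_0$, the coefficient $\theta^*(a)$), and that $F_0$ is $\phi_0$-computable (there is an algorithm that computes for $f\in F_0$ a pair $(g,\phi_0(f))$ with $g\in F_0$ and $f=\Delta(g)+\phi_0(f)$). Then, for $0\le i\le n$, $E_i$ is $\phi_i$-computable: there is an algorithm that computes for $f\in E_i$, given by its coefficients as a polynomial in $t_1,\dots,t_i$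 over $F_0$, a pair $(g,\phi_i(f))\in E_i^2$ with $f=\Delta(g)+\phi_i(f)$. Here it is not assumed that shift equivalence of polynomials in $F_{i-1}[t_i]$ can be decided or solved, nor that the sets $S_i$ are computable. -/

import Mathlib

universe u v w

open Polynomial

noncomputable section

/-! ### Difference fields, the forward shift operator, complete reductions -/

/-- The constant field `{c | σ c = c}` of a difference field `(F, σ)`. -/
def constField {F : Type u} [Field F] (σ : F ≃+* F) : Subfield F :=
  RingHom.eqLocusField (σ : F →+* F) (RingHom.id F)

/-- The operator `Δ f = σ f - f` of a difference field extension `(L, σ)` of `(F, σ₀)`, as a map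
that is linear over the constants of `(F, σ₀)`. -/
def shiftDiff {F : Type u} {L : Type v} [Field F] [Field L] [Algebra F L]
    (σ₀ : F ≃+* F) (σ : L ≃+* L) (h : ∀ a, σ (algebraMap F L a) = algebraMap F L (σ₀ a)) :
    L →ₗ[constField σ₀] L where
  toFun f := σ f - f
  map_add' f g := by rw [map_add]; ring
  map_smul' c f := by
    have hc : σ₀ (c : F) = c := c.2
    have hs : c • f = algebraMap F L (c : F) * f := Algebra.smul_def (c : F) f
    have hs' : c • (σ f - f) = algebraMap F L (c : F) * (σ f - f) :=
      Algebra.smul_def (c : F) (σ f - f)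
    rw [RingHom.id_apply, hs, hs', map_mul, h, hc]
    ring

/-- The operator `Δ` of a single difference field. -/
def groundDiff {F : Type u} [Field F] (σ₀ : F ≃+* F) : F →ₗ[constField σ₀] F :=
  shiftDiff σ₀ σ₀ (fun _ => rfl)

/-- A linear operator `φ` on `V` is a complete reduction for the subspace `U` if `f - φ f ∈ U` for
all `f`, and `ker φ = U`. -/
structure IsCompleteReduction {C : Type u} {V : Type v} [Field C] [AddCommGroup V] [Module C V]
    (U : Submodule C V) (φ : V →ₗ[C] V) : Prop where
  sub_mem : ∀ f, f - φ f ∈ U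
  ker_eq : LinearMap.ker φ = U

/-- The summable space `Δ(V)`, as a subspace of `V` (used for `V` with `Δ(V) ⊆ V`). -/
def summableSpace {C : Type u} {L : Type v} [Field C] [AddCommGroup L] [Module C L]
    (Δ : L →ₗ[C] L) (V : Submodule C L) : Submodule C V :=
  (V.map Δ).submoduleOf V

open Classical in
/-- The coordinate functional `θ^*` of an element `θ` of a basis `B` of `V`: the linear map with
value `1` at `θ` and `0` at all other elements of `B`. -/
def coordFunctional {C : Type u} {V : Type v} [Field C] [AddCommGroup V] [Module C V]
    (B : Set V) (θ : V) : V →ₗ[C] C :=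
  if h : ∃ l : V →ₗ[C] C, l θ = 1 ∧ ∀ ξ ∈ B, ξ ≠ θ → l ξ = 0 then h.choose else 0

/-! ### Towers of `Σ^*`-extensions -/

/-- The field `F_i = F₀(t_1, …, t_i)`; the generator `t_{j+1}` is `t j`. -/
def towerField (F₀ : Type u) {L : Type v} [Field F₀] [Field L] [Algebra F₀ L]
    (t : ℕ → L) (i : ℕ) : IntermediateField F₀ L :=
  IntermediateField.adjoin F₀ (t '' {j | j < i})

/-- The ring `E_i = F₀[t_1, …, t_i]`; the generator `t_{j+1}` is `t j`. -/
def towerRing (F₀ : Type u) {L : Type v} [Field F₀] [Field L] [Algebra F₀ L]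
    (t : ℕ → L) (i : ℕ) : Subalgebra F₀ L :=
  Algebra.adjoin F₀ (t '' {j | j < i})

/-- A tower `L = F₀(t_1)…(t_n)` of `Σ^*`-extensions of the difference field `(F₀, σ₀)`. The monomial
`t_{i+1}` is `t i`; the values `t i` with `n ≤ i` play no role. -/
structure SigmaTower (F₀ : Type u) (L : Type v) [Field F₀] [Field L] [Algebra F₀ L] (n : ℕ) where
  σ₀ : F₀ ≃+* F₀
  σ : L ≃+* L
  t : ℕ → L
  σ_algebraMap : ∀ a, σ (algebraMap F₀ L a) = algebraMap F₀ L (σ₀ a)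
  field_eq_top : towerField F₀ t n = ⊤
  transcendental : ∀ i < n, Transcendental (towerField F₀ t i) (t i)
  diff_mem : ∀ i < n, σ (t i) - t i ∈ towerField F₀ t i
  const_eq : ∀ x : L, σ x = x → ∃ c : F₀, algebraMap F₀ L c = x

namespace SigmaTower

variable {F₀ : Type u} {L : Type v} [Field F₀] [Field L] [Algebra F₀ L] {n : ℕ}

/-- The common constant field `C`, as a subfield of `F₀`. -/
abbrev C (T : SigmaTower F₀ L n) : Subfield F₀ := constField T.σ₀

/-- `Δ` on the top field of the tower. -/
def Δ (T : SigmaTower F₀ L n) : L →ₗ[T.C] L := shiftDiff T.σ₀ T.σ T.σ_algebraMap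

/-- `F_i` as a `C`-vector space. -/
def fieldSpace (T : SigmaTower F₀ L n) (i : ℕ) : Submodule T.C L :=
  (Subalgebra.toSubmodule (towerField F₀ T.t i).toSubalgebra).restrictScalars T.C

/-- `E_i` as a `C`-vector space. -/
def ringSpace (T : SigmaTower F₀ L n) (i : ℕ) : Submodule T.C L :=
  (Subalgebra.toSubmodule (towerRing F₀ T.t i)).restrictScalars T.C

lemma ringSpace_le_fieldSpace (T : SigmaTower F₀ L n) (i : ℕ) :
    T.ringSpace i ≤ T.fieldSpace i :=
  fun _ hx => IntermediateField.algebra_adjoin_le_adjoin F₀ _ hx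

/-- `Δ(t_{i+1})` as an element of `F_i`. -/
def diffGen (T : SigmaTower F₀ L n) (i : ℕ) (hi : i < n) : T.fieldSpace i :=
  ⟨T.Δ (T.t i), T.diff_mem i hi⟩

/-- The tower is one of `Σ^*`-ring extensions: `Δ(t_i) ∈ E_{i-1}`. -/
def IsRingTower (T : SigmaTower F₀ L n) : Prop :=
  ∀ i < n, T.Δ (T.t i) ∈ T.ringSpace i

lemma mem_fieldSpace_zero (T : SigmaTower F₀ L n) (x : L) :
    x ∈ T.fieldSpace 0 ↔ ∃ a : F₀, algebraMap F₀ L a = x := by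
  change x ∈ towerField F₀ T.t 0 ↔ _
  simp [towerField, IntermediateField.mem_bot]

/-- The identification of the ground field `F₀` with the bottom of the tower. -/
def baseEquiv (T : SigmaTower F₀ L n) : F₀ ≃ₗ[T.C] T.fieldSpace 0 :=
  LinearEquiv.ofBijective
    { toFun := fun a => ⟨algebraMap F₀ L a, (T.mem_fieldSpace_zero _).2 ⟨a, rfl⟩⟩
      map_add' := fun a b => Subtype.ext (map_add (algebraMap F₀ L) a b)
      map_smul' := fun c a => Subtype.ext <| by
        change algebraMap F₀ L ((c : F₀) * a) = (c : F₀) • algebraMap F₀ L a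
        rw [map_mul, Algebra.smul_def] }
    ⟨fun _ _ h => (algebraMap F₀ L).injective (congrArg Subtype.val h),
      fun x => by
        obtain ⟨a, ha⟩ := (T.mem_fieldSpace_zero x.1).1 x.2
        exact ⟨a, Subtype.ext ha⟩⟩

/-! ### The canonical basis, indicators -/

/-- The canonical `F_i`-basis of `F_{i+1} = F_i(t)`: all powers `t^k`, and all `t^k / q^j` with `q`
monic irreducible, `k < deg q`, `1 ≤ j`. -/
def canonicalStep (T : SigmaTower F₀ L n) (i : ℕ) : Set L :=
  {x | (∃ k : ℕ, x = T.t i ^ k) ∨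
    ∃ (q : (towerField F₀ T.t i)[X]) (k j : ℕ), q.Monic ∧ Irreducible q ∧ k < q.natDegree ∧ 1 ≤ j ∧
      x = T.t i ^ k / aeval (T.t i) q ^ j}

/-- The `Θ₀`-canonical `C`-basis of `F_i`: all products `θ₀ θ₁ ⋯ θ_i` with `θ₀ ∈ Θ₀` and `θ_j` in
the canonical `F_{j-1}`-basis of `F_j`. -/
def canonicalBasis (T : SigmaTower F₀ L n) (Θ₀ : Set F₀) : ℕ → Set L
  | 0 => algebraMap F₀ L '' Θ₀
  | i + 1 => {x | ∃ ξ ∈ canonicalBasis T Θ₀ i, ∃ η ∈ T.canonicalStep i, x = ξ * η}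

/-- The coordinate functional `θ^* : F_i → C` with respect to the `Θ₀`-canonical basis. -/
def canonicalCoord (T : SigmaTower F₀ L n) (Θ₀ : Set F₀) (i : ℕ) (θ : T.fieldSpace i) :
    T.fieldSpace i →ₗ[T.C] T.C :=
  coordFunctional {ξ | (ξ : L) ∈ T.canonicalBasis Θ₀ i} θ

/-- The indicator of `f`: the least `i` with `f ∈ F_i`. -/
def indicator (T : SigmaTower F₀ L n) (f : L) : ℕ := sInf {i | f ∈ T.fieldSpace i}

/-! ### The complementary space -/

/-- The monic irreducible polynomials in `F_i[t]`, `t = t_{i+1}`, as elements of `F_{i+1}`. -/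
def monicIrreducibles (T : SigmaTower F₀ L n) (i : ℕ) : Set L :=
  {x | ∃ p : (towerField F₀ T.t i)[X], p.Monic ∧ Irreducible p ∧ x = aeval (T.t i) p}

/-- `σ`-equivalence of elements of `F_i[t]`: `p = c σ^l(q)` with `c ∈ F_i` nonzero and `l ∈ ℤ`. -/
def ShiftEquivalent (T : SigmaTower F₀ L n) (i : ℕ) (p q : L) : Prop :=
  ∃ c ∈ T.fieldSpace i, c ≠ 0 ∧ ∃ l : ℤ, p = c * (T.σ ^ l) q

/-- `S` is a set of representatives of the classes of `σ`-equivalence on the monic irreducible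
polynomials in `F_i[t]`. -/
def IsRepresentatives (T : SigmaTower F₀ L n) (i : ℕ) (S : Set L) : Prop :=
  S ⊆ T.monicIrreducibles i ∧
    ∀ q ∈ T.monicIrreducibles i, ∃! p, p ∈ S ∧ T.ShiftEquivalent i p q

/-- The space `U_S` of the proper rational functions in `F_i(t)` whose denominator is a product of
elements of `S`. -/
def properComplement (T : SigmaTower F₀ L n) (i : ℕ) (S : Set L) : Submodule T.C L :=
  Submodule.span T.C
    {x | ∃ a b : (towerField F₀ T.t i)[X], a.degree < b.degree ∧
      aeval (T.t i) b ∈ Submonoid.closure S ∧ x = aeval (T.t i) a / aeval (T.t i) b}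

/-- The `θ`-complement `V_θ = ⨁_k (im φ ∩ ker θ^*) t^k` inside `F_i[t]`, where `φ` is a reduction on
`F_i` and `l = θ^*`. -/
def polyComplement (T : SigmaTower F₀ L n) (i : ℕ) (l : T.fieldSpace i →ₗ[T.C] T.C)
    (φ : T.fieldSpace i →ₗ[T.C] T.fieldSpace i) : Submodule T.C L :=
  Submodule.span T.C
    {x | ∃ a ∈ LinearMap.range φ ⊓ LinearMap.ker l, ∃ k : ℕ, x = (a : L) * T.t i ^ k}

/-- `U_S ⊕ V_θ` as a subspace of `F_{i+1}`. -/
def complement (T : SigmaTower F₀ L n) (i : ℕ) (S : Set L) (l : T.fieldSpace i →ₗ[T.C] T.C)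
    (φ : T.fieldSpace i →ₗ[T.C] T.fieldSpace i) : Submodule T.C (T.fieldSpace (i + 1)) :=
  (T.properComplement i S ⊔ T.polyComplement i l φ).submoduleOf (T.fieldSpace (i + 1))

/-! ### The complete reductions of the tower -/

open Classical in
/-- The map `ψ_{(S, θ)}` on `F_{i+1}` obtained from `φ` on `F_i`: the projection onto `U_S ⊕ V_θ`
along `Δ(F_{i+1})`. -/
def reductionStep (T : SigmaTower F₀ L n) (i : ℕ) (S : Set L) (l : T.fieldSpace i →ₗ[T.C] T.C)
    (φ : T.fieldSpace i →ₗ[T.C] T.fieldSpace i) :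
    T.fieldSpace (i + 1) →ₗ[T.C] T.fieldSpace (i + 1) :=
  if h : IsCompl (T.complement i S l φ) (summableSpace T.Δ (T.fieldSpace (i + 1))) then
    (T.complement i S l φ).projection (summableSpace T.Δ (T.fieldSpace (i + 1))) h
  else 0

/-- The maps `φ_i` on `F_i` defined recursively from `φ₀`, the sets `S_{i+1} = S i` of
representatives and the elements `θ_{i+1} = θ i`. -/
def reduction (T : SigmaTower F₀ L n) (Θ₀ : Set F₀) (φ₀ : F₀ →ₗ[T.C] F₀) (S : ℕ → Set L)
    (θ : (i : ℕ) → T.fieldSpace i) : (i : ℕ) → (T.fieldSpace i →ₗ[T.C] T.fieldSpace i)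
  | 0 => T.baseEquiv.conj φ₀
  | i + 1 => T.reductionStep i (S i) (T.canonicalCoord Θ₀ i (θ i)) (reduction T Θ₀ φ₀ S θ i)

/-- The `θ_{i+1} = θ i` are the first components of second pairs: `θ_{i+1}` is an element of the
canonical basis that is effective for `φ_i(Δ(t_{i+1}))` and has the same indicator. -/
def IsSecondPairs (T : SigmaTower F₀ L n) (Θ₀ : Set F₀) (φ₀ : F₀ →ₗ[T.C] F₀) (S : ℕ → Set L)
    (θ : (i : ℕ) → T.fieldSpace i) : Prop :=
  ∀ (i : ℕ) (hi : i < n),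
    (θ i : L) ∈ T.canonicalBasis Θ₀ i ∧
    T.canonicalCoord Θ₀ i (θ i) (T.reduction Θ₀ φ₀ S θ i (T.diffGen i hi)) ≠ 0 ∧
    T.indicator (θ i) = T.indicator (T.reduction Θ₀ φ₀ S θ i (T.diffGen i hi))

end SigmaTower

/-! ### Computability -/

/-- The difference field `(F, σ)` is computable for the given coding of its elements. (A
`Primcodable` coding is injective, so equality is decidable.) -/
structure IsComputableDifferenceField (F : Type u) [Field F] [Primcodable F] (σ : F ≃+* F) :
    Prop where
  add : Computable₂ (fun a b : F => a + b)
  neg : Computable (fun a : F => -a)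
  mul : Computable₂ (fun a b : F => a * b)
  inv : Computable (fun a : F => a⁻¹)
  shift : Computable (fun a : F => σ a)

/-- A basis of a field over a subfield is effective if one can compute, for `a ≠ 0`, a basis element
with nonzero coefficient in `a`, and the coefficient of a given basis element in a given `a`. -/
def IsEffectiveBasis {F : Type u} [Field F] [Primcodable F] {C : Subfield F} {ι : Type w}
    (b : Module.Basis ι C F) : Prop :=
  (∃ find : F → F, Computable find ∧ ∀ a, a ≠ 0 → ∃ k, find a = b k ∧ b.repr a k ≠ 0) ∧
  ∃ coeff : F → F → F, Computable₂ coeff ∧ ∀ k a, coeff (b k) a = (b.repr a k : F)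

/-- `V`, with elements coded by `ν : α → V`, is `φ`-computable: some algorithm computes from a code
of `f` codes of `g` and `φ f` with `f = Δ g + φ f`. -/
def IsPhiComputable {α : Type u} {C : Type v} {V : Type w} [Primcodable α] [Field C]
    [AddCommGroup V] [Module C V] (ν : α → V) (Δ φ : V →ₗ[C] V) : Prop :=
  Function.Surjective ν ∧
  ∃ A : α → α × α, Computable A ∧
    ∀ a, ν (A a).2 = φ (ν a) ∧ ν a = Δ (ν (A a).1) + ν (A a).2

/-- Codes for recursive polynomials in `i` variables with coefficients in `A`: a polynomial in
`i + 1` variables is the list of its coefficients, which are polynomials in `i` variables. -/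
def PolyCode (A : Type u) : ℕ → Type u
  | 0 => A
  | i + 1 => List (PolyCode A i)

instance PolyCode.instPrimcodable (A : Type u) [Primcodable A] :
    (i : ℕ) → Primcodable (PolyCode A i)
  | 0 => inferInstanceAs (Primcodable A)
  | i + 1 =>
    letI := PolyCode.instPrimcodable A i
    inferInstanceAs (Primcodable (List (PolyCode A i)))

namespace SigmaTower

variable {F₀ : Type u} {L : Type v} [Field F₀] [Field L] [Algebra F₀ L] {n : ℕ}

/-- The element coded by a recursive polynomial; `[c₀, …, c_d]` codes `∑ c_k t_{i+1}^k`. -/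
def evalCode (T : SigmaTower F₀ L n) : (i : ℕ) → PolyCode F₀ i → L
  | 0 => fun a => algebraMap F₀ L a
  | i + 1 => fun l : List (PolyCode F₀ i) =>
      l.foldr (fun c x => evalCode T i c + T.t i * x) 0

lemma evalCode_mem (T : SigmaTower F₀ L n) (i : ℕ) (c : PolyCode F₀ i) :
    T.evalCode i c ∈ T.ringSpace i := by
  change T.evalCode i c ∈ towerRing F₀ T.t i
  induction i with
  | zero => exact (towerRing F₀ T.t 0).algebraMap_mem c
  | succ i ih =>
    have hle : towerRing F₀ T.t i ≤ towerRing F₀ T.t (i + 1) :=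
      Algebra.adjoin_mono (Set.image_mono fun j (hj : j < i) => Nat.lt_succ_of_lt hj)
    have ht : T.t i ∈ towerRing F₀ T.t (i + 1) :=
      Algebra.subset_adjoin ⟨i, Nat.lt_succ_self i, rfl⟩
    change List (PolyCode F₀ i) at c
    change c.foldr (fun c x => T.evalCode i c + T.t i * x) 0 ∈ _
    induction c with
    | nil => exact zero_mem _
    | cons a l ihl => exact add_mem (hle (ih a)) (mul_mem ht ihl)

/-- The coding of the elements of `E_i` by recursive polynomials over `F₀`. -/
def ringCoding (T : SigmaTower F₀ L n) (i : ℕ) (c : PolyCode F₀ i) : T.ringSpace i :=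
  ⟨T.evalCode i c, T.evalCode_mem i c⟩

end SigmaTower

end

noncomputable section

/-! Everything is an induction over the tower; one step passes from a complete reduction `φ` of
`F_i` to `F_{i+1} = F_i(t)`. Write `a = Δ(t)` and `l = θ^*`, with `l (φ a) ≠ 0`, and `W = im φ ∩ ker
l`, the coefficient space of `V_θ`.

Spanning. By partial fractions it suffices to treat polynomials and proper fractions `p / q^j`. A
power of `σ` carries `q` to its representative in `S`, and `σ^m x - x` is summable, so `p / q^j`
lies in `U_S` modulo `Δ(F_{i+1})` (`mem_sup_of_proper`). For polynomials, subtracting a suitable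
constant multiple `λ` of `φ a` from `φ c` kills `l`; hence each `c ∈ F_i` has the form `Δ g + λ a +
w` with `w ∈ W`. In degree `N` the term `λ a` is absorbed by the difference of `λ t^{N+1} / (N+1)`,
which is where characteristic `0` enters, and the degree drops (`exists_eq_shiftPoly_sub_add`).

Directness. Suppose `Δ f ∈ U_S ⊕ V_θ`. If `f` had a pole, then the two ends of its shift orbit would
produce two different poles of `Δ f` in one orbit, both in `S`; this is impossible for a set of
representatives because orbits are infinite. So `f` is a polynomial
(`exists_aeval_eq_of_regularAt_sub`), the `U_S` part vanishes by degree, and comparing the two top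
coefficients shows that `f` is constant (`shiftPoly_eq_self_of_coeff_mem`).

A suitable `θ` exists because `t` is transcendental and constants are not extended, so `Δ(t)` is not
summable in `F_i` and `φ(Δ t) ≠ 0`; some basis element of top indicator must then occur in it.

The polynomial half of the argument needs from the coefficients only a subalgebra stable under `σ`,
`φ` and summation that contains `a`. Applied to `E_i` instead of `F_i`, it shows that `φ_{i+1}`
preserves `E_{i+1}` and that the summand can be taken there, with no contribution from `U_S`.

This also explains why shift equivalence never has to be decided. For `f ∈ E_{i+1}` any identity `f
= Δ g + r` with all coefficients of `r` in `W` already certifies `r = φ_{i+1}(f)`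
(`coe_reductionStep_eq_aeval`). Membership of a code in `W` is decidable: `φ_i` is computable by
induction, and `θ^*` is computable on codes. An unbounded search over pairs `(g, r)` therefore halts
with the right answer; the `S_i` and codes for proper fractions never appear. -/

/-- The ring automorphism of `K[X]` that acts as `τ` on the coefficients and maps `X` to
`X + a`. -/
def shiftPoly {K : Type*} [Field K] (τ : K ≃+* K) (a : K) : K[X] ≃+* K[X] :=
  (Polynomial.mapEquiv τ).trans (Polynomial.algEquivAevalXAddC a : K[X] ≃ₐ[K] K[X]).toRingEquiv

/-! ### The shift on polynomials and summation by descending degree -/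

section ShiftPoly

variable {K : Type*} [Field K] (τ : K ≃+* K) (a : K)

lemma shiftPoly_apply (p : K[X]) : shiftPoly τ a p = (p.map (τ : K →+* K)).comp (X + C a) := by
  simp [shiftPoly, Polynomial.aeval_def, Polynomial.comp, Polynomial.algebraMap_eq]

lemma shiftPoly_C (c : K) : shiftPoly τ a (C c) = C (τ c) := by
  simp [shiftPoly_apply]

lemma shiftPoly_C_mul_X_pow (c : K) (n : ℕ) :
    shiftPoly τ a (C c * X ^ n) = C (τ c) * (X + C a) ^ n := by
  simp [shiftPoly_apply]

lemma natDegree_shiftPoly (p : K[X]) : (shiftPoly τ a p).natDegree = p.natDegree := by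
  rw [shiftPoly_apply, natDegree_comp, natDegree_X_add_C, mul_one,
    natDegree_map_eq_of_injective τ.injective]

lemma degree_shiftPoly (p : K[X]) : (shiftPoly τ a p).degree = p.degree := by
  rcases eq_or_ne p 0 with rfl | hp
  · simp
  · rw [degree_eq_natDegree hp, degree_eq_natDegree (by simpa using hp), natDegree_shiftPoly]

lemma leadingCoeff_shiftPoly (p : K[X]) :
    (shiftPoly τ a p).leadingCoeff = τ p.leadingCoeff := by
  rw [shiftPoly_apply, leadingCoeff_comp (by simp), leadingCoeff_map_of_injective τ.injective]
  simp

lemma monic_shiftPoly {p : K[X]} (hp : p.Monic) : (shiftPoly τ a p).Monic := by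
  rw [shiftPoly_apply]
  exact (hp.map _).comp_X_add_C a

lemma shiftPoly_dvd_shiftPoly {p q : K[X]} : shiftPoly τ a p ∣ shiftPoly τ a q ↔ p ∣ q :=
  map_dvd_iff (shiftPoly τ a)

/-- Binomial expansion of each `(X + a)^j`. The truncated subtraction `j - k` is harmless, since the
binomial coefficient vanishes for `j < k`. -/
lemma coeff_shiftPoly {p : K[X]} {N : ℕ} (hp : p.natDegree < N) (k : ℕ) :
    (shiftPoly τ a p).coeff k =
      ∑ j ∈ Finset.range N, τ (p.coeff j) * (a ^ (j - k) * (j.choose k : K)) := by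
  conv_lhs => rw [p.as_sum_range_C_mul_X_pow' hp, map_sum, finsetSum_coeff]
  refine Finset.sum_congr rfl fun j _ => ?_
  rw [shiftPoly_C_mul_X_pow, coeff_C_mul, coeff_X_add_C_pow]

lemma coeff_shiftPoly_mem {R : Subring K} (hτ : ∀ x ∈ R, τ x ∈ R) (ha : a ∈ R) {p : K[X]}
    (hp : ∀ k, p.coeff k ∈ R) (k : ℕ) : (shiftPoly τ a p).coeff k ∈ R := by
  rw [coeff_shiftPoly τ a (Nat.lt_succ_self _)]
  exact sum_mem fun j _ => mul_mem (hτ _ (hp j)) (mul_mem (pow_mem ha _) (natCast_mem R _))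

/-- If every coefficient is, up to a constant multiple of `a`, summable modulo `W`, then every
polynomial is summable modulo the polynomials with coefficients in `W`. -/
theorem exists_eq_shiftPoly_sub_add [CharZero K] {R : Subring K} {W : AddSubgroup K}
    (hτ : ∀ x ∈ R, τ x ∈ R) (ha : a ∈ R) (hinv : ∀ n : ℕ, (n : K)⁻¹ ∈ R)
    (H : ∀ c ∈ R, ∃ g ∈ R, ∃ l ∈ R, ∃ w ∈ R, w ∈ W ∧ τ l = l ∧ c = τ g - g + l * a + w)
    (p : K[X]) (hp : ∀ k, p.coeff k ∈ R) :
    ∃ g r : K[X], (∀ k, g.coeff k ∈ R) ∧ (∀ k, r.coeff k ∈ R) ∧ (∀ k, r.coeff k ∈ W) ∧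
      p = shiftPoly τ a g - g + r := by
  suffices ∀ (N : ℕ) (p : K[X]), (∀ k, N ≤ k → p.coeff k = 0) → (∀ k, p.coeff k ∈ R) →
      ∃ g r : K[X], (∀ k, g.coeff k ∈ R) ∧ (∀ k, r.coeff k ∈ R) ∧ (∀ k, r.coeff k ∈ W) ∧
        p = shiftPoly τ a g - g + r from
    this (p.natDegree + 1) p (fun k hk => coeff_eq_zero_of_natDegree_lt hk) hp
  intro N
  induction N with
  | zero =>
    intro p hp _
    refine ⟨0, 0, ?_, ?_, ?_, ?_⟩
    · simp [zero_mem]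
    · simp [zero_mem]
    · simp [zero_mem]
    · ext k
      simpa using hp k (Nat.zero_le k)
  | succ N ih =>
    intro p hpN hpR
    obtain ⟨g, hg, l, hl, w, hwR, hwW, hτl, hc⟩ := H (p.coeff N) (hpR N)
    have hN : ((N : K) + 1) ≠ 0 := by exact_mod_cast Nat.succ_ne_zero N
    -- The difference of `m X^(N+1)` has `(N+1) m a` as its coefficient at `X^N`, so this choice
    -- yields the required `l a`.
    set m : K := l * ((N + 1 : ℕ) : K)⁻¹ with hm
    have hmR : m ∈ R := mul_mem hl (hinv _)
    have hτm : τ m = m := by rw [hm, map_mul, map_inv₀, map_natCast, hτl]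
    have hmN : m * ((N : K) + 1) = l := by
      rw [hm]; push_cast; field_simp
    set G : K[X] := C g * X ^ N + C m * X ^ (N + 1) with hG
    have hGR : ∀ k, G.coeff k ∈ R := by
      intro k
      simp only [hG, coeff_add, coeff_C_mul_X_pow]
      refine add_mem ?_ ?_
      · split_ifs <;> simp [hg, zero_mem]
      · split_ifs <;> simp [hmR, zero_mem]
    have hrR : ∀ k, (C w * X ^ N : K[X]).coeff k ∈ R := by
      intro k
      rw [coeff_C_mul_X_pow]
      split_ifs <;> simp [hwR, zero_mem]
    have hrW : ∀ k, (C w * X ^ N : K[X]).coeff k ∈ W := by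
      intro k
      rw [coeff_C_mul_X_pow]
      split_ifs <;> simp [hwW, zero_mem]
    have hσG : shiftPoly τ a G = C (τ g) * (X + C a) ^ N + C m * (X + C a) ^ (N + 1) := by
      rw [hG, map_add, shiftPoly_C_mul_X_pow, shiftPoly_C_mul_X_pow, hτm]
    have hσGR := coeff_shiftPoly_mem τ a hτ ha hGR
    -- The difference of `G` has no term in degree `N + 1`, because `m` is fixed by `τ`, and in
    -- degree `N` it accounts for all of `p.coeff N` except `w`.
    obtain ⟨g', r', hg', hr', hrW', h'⟩ :=
      ih (p - (shiftPoly τ a G - G) - C w * X ^ N) (by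
        intro k hk
        rw [coeff_sub, coeff_sub, coeff_sub, hσG]
        simp only [coeff_add, coeff_C_mul, coeff_X_add_C_pow, hG, coeff_X_pow]
        rcases Nat.lt_or_ge (N + 1) k with h | h
        · rw [hpN k (by omega), Nat.choose_eq_zero_of_lt h,
            Nat.choose_eq_zero_of_lt (by omega : N < k)]
          rw [if_neg (by omega), if_neg (by omega)]
          simp
        · rcases (by omega : k = N ∨ k = N + 1) with rfl | rfl
          · simp only [hc, Nat.choose_self, Nat.choose_succ_self_right, ← hmN]
            simp
            ring
          · simp [hpN])
        (fun k => by
          simp only [coeff_sub]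
          exact sub_mem (sub_mem (hpR k) (sub_mem (hσGR k) (hGR k))) (hrR k))
    refine ⟨g' + G, r' + C w * X ^ N, fun k => ?_, fun k => ?_, fun k => ?_, ?_⟩
    · rw [coeff_add]; exact add_mem (hg' k) (hGR k)
    · rw [coeff_add]; exact add_mem (hr' k) (hrR k)
    · rw [coeff_add]; exact add_mem (hrW' k) (hrW k)
    · rw [map_add]
      linear_combination h'

/-- A polynomial whose difference has coefficients in `W` is constant. -/
theorem shiftPoly_eq_self_of_coeff_mem [CharZero K] {W : AddSubgroup K}
    (H : ∀ g l, τ l = l → τ g - g + l * a ∈ W → l = 0 ∧ τ g = g)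
    (g : K[X]) (hg : ∀ k, (shiftPoly τ a g - g).coeff k ∈ W) : shiftPoly τ a g = g := by
  -- The top coefficient of the difference is `τ c - c`, so `H` applies with `l = 0`.
  have hlead : τ (g.coeff g.natDegree) = g.coeff g.natDegree := by
    have h := hg g.natDegree
    rw [coeff_sub, coeff_shiftPoly τ a (Nat.lt_succ_self _), Finset.sum_range_succ,
      Finset.sum_eq_zero (fun j hj => by
        rw [Nat.choose_eq_zero_of_lt (Finset.mem_range.1 hj)]; simp)] at h
    exact (H (g.coeff g.natDegree) 0 (map_zero _) (by simpa using h)).2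
  rcases Nat.eq_zero_or_pos g.natDegree with h0 | hpos
  · rw [eq_C_of_natDegree_eq_zero h0, shiftPoly_C]
    rw [h0] at hlead
    rw [hlead]
  · exfalso
    obtain ⟨d, hd⟩ := Nat.exists_eq_succ_of_ne_zero hpos.ne'
    have h := hg d
    rw [coeff_sub, coeff_shiftPoly τ a (Nat.lt_succ_self _), hd, Finset.sum_range_succ,
      Finset.sum_range_succ, Finset.sum_eq_zero (fun j hj => by
        rw [Nat.choose_eq_zero_of_lt (Finset.mem_range.1 hj)]; simp)] at h
    rw [hd] at hlead
    -- In degree `d = deg g - 1` the difference reads `τ g_d - g_d + (d+1) g_{d+1} a`; `H` then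
    -- forces the leading coefficient to vanish.
    have h1 := (H (g.coeff d) (((d + 1 : ℕ) : K) * g.coeff d.succ)
      (by rw [map_mul, map_natCast, hlead]) (by
        convert h using 1
        rw [hlead]
        simp
        ring)).1
    rcases mul_eq_zero.1 h1 with h2 | h2
    · exact Nat.succ_ne_zero d (by exact_mod_cast h2)
    · rw [← hd] at h2
      have : g = 0 := by simpa using h2
      simp [this] at hpos

end ShiftPoly

/-! ### Monomials and poles of rational functions -/

/-- `t` is a `Σ^*`-monomial over `(K, τ)` with `σ t = t + a`, inside the difference field
`(L, σ)`. -/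
structure IsSigmaMonomial {K L : Type*} [Field K] [Field L] [Algebra K L] (σ : L ≃+* L)
    (τ : K ≃+* K) (t : L) (a : K) : Prop where
  transcendental : Transcendental K t
  map_algebraMap : ∀ c, σ (algebraMap K L c) = algebraMap K L (τ c)
  map_gen : σ t = t + algebraMap K L a
  const : ∀ x, σ x = x → ∃ c, algebraMap K L c = x

/-- `f` is a quotient of polynomials in `t` whose denominator is not divisible by `q`. -/
def RegularAt {K L : Type*} [Field K] [Field L] [Algebra K L] (t : L) (q : K[X]) (f : L) : Prop :=
  ∃ a b : K[X], ¬ q ∣ b ∧ f = aeval t a / aeval t b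

section Regular

variable {K L : Type*} [Field K] [Field L] [Algebra K L] {t : L}

lemma aeval_ne_zero_of_transcendental (ht : Transcendental K t) {b : K[X]} (hb : b ≠ 0) :
    aeval t b ≠ 0 := fun h => hb (transcendental_iff.1 ht b h)

lemma RegularAt.sub (ht : Transcendental K t) {q : K[X]} (hq : Prime q) {f g : L}
    (hf : RegularAt t q f) (hg : RegularAt t q g) : RegularAt t q (f - g) := by
  obtain ⟨a, b, hb, rfl⟩ := hf
  obtain ⟨c, d, hd, rfl⟩ := hg
  refine ⟨a * d - b * c, b * d, fun h => (hq.dvd_or_dvd h).elim hb hd, ?_⟩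
  have h1 := aeval_ne_zero_of_transcendental ht (b := b) (by rintro rfl; exact hb (dvd_zero _))
  have h2 := aeval_ne_zero_of_transcendental ht (b := d) (by rintro rfl; exact hd (dvd_zero _))
  rw [div_sub_div _ _ h1 h2, map_sub, map_mul, map_mul, map_mul]

lemma regularAt_aeval {q : K[X]} (hq : Prime q) (p : K[X]) : RegularAt t q (aeval t p) :=
  ⟨p, 1, fun h => hq.not_isUnit (isUnit_of_dvd_one h), by simp⟩

lemma RegularAt.neg {q : K[X]} {f : L} (hf : RegularAt t q f) : RegularAt t q (-f) := by
  obtain ⟨a, b, hb, rfl⟩ := hf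
  exact ⟨-a, b, hb, by rw [map_neg, neg_div]⟩

lemma RegularAt.add (ht : Transcendental K t) {q : K[X]} (hq : Prime q) {f g : L}
    (hf : RegularAt t q f) (hg : RegularAt t q g) : RegularAt t q (f + g) := by
  simpa using hf.sub ht hq hg.neg

/-- A rational function that is regular everywhere is a polynomial. -/
lemma exists_aeval_eq_of_regularAt (ht : Transcendental K t) {a b : K[X]} (hb : b ≠ 0)
    (h : ∀ q : K[X], q.Monic → Irreducible q → RegularAt t q (aeval t a / aeval t b)) :
    ∃ p : K[X], aeval t p = aeval t a / aeval t b := by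
  classical
  induction hn : b.natDegree using Nat.strong_induction_on generalizing a b with
  | _ n ih =>
    by_cases hu : IsUnit b
    · obtain ⟨c, hc⟩ := hu.exists_right_inv
      refine ⟨a * c, ?_⟩
      rw [eq_div_iff (aeval_ne_zero_of_transcendental ht hb), ← map_mul, mul_assoc, mul_comm c,
        hc, mul_one]
    · obtain ⟨q, hqm, hqi, b', rfl⟩ := Polynomial.exists_monic_irreducible_factor b hu
      have hb' : b' ≠ 0 := right_ne_zero_of_mul hb
      obtain ⟨c, d, hd, hcd⟩ := h q hqm hqi
      have hd0 : d ≠ 0 := by rintro rfl; exact hd (dvd_zero _)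
      rw [div_eq_div_iff (aeval_ne_zero_of_transcendental ht hb)
        (aeval_ne_zero_of_transcendental ht hd0), ← map_mul, ← map_mul] at hcd
      have hcd' : a * d = c * (q * b') := transcendental_iff_injective.1 ht hcd
      -- Regularity at the prime `q` forces `q` to cancel from the fraction, which lowers the degree
      -- of the denominator.
      have hqa : q ∣ a := by
        have : q ∣ a * d := ⟨c * b', by rw [hcd']; ring⟩
        exact (hqi.prime.dvd_or_dvd this).resolve_right hd
      obtain ⟨a', rfl⟩ := hqa
      have hq0 := aeval_ne_zero_of_transcendental ht hqi.ne_zero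
      have heq : aeval t (q * a') / aeval t (q * b') = aeval t a' / aeval t b' := by
        rw [map_mul, map_mul, mul_div_mul_left _ _ hq0]
      rw [heq] at h ⊢
      refine ih b'.natDegree ?_ hb' h rfl
      rw [← hn, natDegree_mul hqi.ne_zero hb']
      have := hqi.natDegree_pos
      omega

end Regular

namespace IsSigmaMonomial

variable {K L : Type*} [Field K] [Field L] [Algebra K L] {σ : L ≃+* L} {τ : K ≃+* K} {t : L}
  {a : K} (h : IsSigmaMonomial σ τ t a)
include h

lemma aeval_injective : Function.Injective (aeval t : K[X] →ₐ[K] L) :=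
  transcendental_iff_injective.1 h.transcendental

lemma aeval_ne_zero {b : K[X]} (hb : b ≠ 0) : aeval t b ≠ 0 :=
  aeval_ne_zero_of_transcendental h.transcendental hb

lemma aeval_shiftPoly (p : K[X]) : aeval t (shiftPoly τ a p) = σ (aeval t p) := by
  induction p using Polynomial.induction_on' with
  | add p q hp hq => simp only [map_add, hp, hq]
  | monomial n c =>
    rw [← C_mul_X_pow_eq_monomial, shiftPoly_C_mul_X_pow]
    simp [h.map_algebraMap, h.map_gen]

lemma aeval_shiftPoly_zpow (l : ℤ) (p : K[X]) :
    aeval t ((shiftPoly τ a ^ l) p) = (σ ^ l) (aeval t p) := by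
  induction l using Int.induction_on generalizing p with
  | zero => simp
  | succ n ih =>
    rw [zpow_add_one, zpow_add_one, RingAut.mul_apply, RingAut.mul_apply, ih, h.aeval_shiftPoly]
  | pred n ih =>
    rw [zpow_sub_one, zpow_sub_one, RingAut.mul_apply, RingAut.mul_apply, ih]
    congr 1
    rw [RingAut.inv_apply, RingAut.inv_apply, RingEquiv.eq_symm_apply, ← h.aeval_shiftPoly,
      RingEquiv.apply_symm_apply]

end IsSigmaMonomial

/-! ### Powers of the shift, orbits of irreducible polynomials and poles of differences -/

section zpow

variable {K : Type*} [Field K] (τ : K ≃+* K) (a : K)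

lemma shiftPoly_zpow_induction {P : K[X] → Prop} (h1 : ∀ p, P p → P (shiftPoly τ a p))
    (h2 : ∀ p, P p → P ((shiftPoly τ a).symm p)) (l : ℤ) {p : K[X]} (hp : P p) :
    P ((shiftPoly τ a ^ l) p) := by
  induction l using Int.induction_on generalizing p with
  | zero => simpa using hp
  | succ n ih =>
    rw [zpow_add_one, RingAut.mul_apply]
    exact ih (h1 _ hp)
  | pred n ih =>
    rw [zpow_sub_one, RingAut.mul_apply, RingAut.inv_apply]
    exact ih (h2 _ hp)

lemma degree_shiftPoly_zpow (l : ℤ) (p : K[X]) :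
    ((shiftPoly τ a ^ l) p).degree = p.degree :=
  shiftPoly_zpow_induction τ a (P := fun q => q.degree = p.degree)
    (fun q hq => by rw [degree_shiftPoly, hq])
    (fun q hq => by rw [← hq, ← degree_shiftPoly τ a, RingEquiv.apply_symm_apply]) l rfl

lemma monic_shiftPoly_zpow (l : ℤ) {p : K[X]} (hp : p.Monic) :
    ((shiftPoly τ a ^ l) p).Monic :=
  shiftPoly_zpow_induction τ a (P := Monic) (fun _ => monic_shiftPoly τ a)
    (fun q hq => by
      have h1 := leadingCoeff_shiftPoly τ a ((shiftPoly τ a).symm q)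
      rw [RingEquiv.apply_symm_apply, hq.leadingCoeff] at h1
      exact τ.injective (by rw [← h1, map_one])) l hp

lemma irreducible_shiftPoly_zpow (l : ℤ) {p : K[X]} (hp : Irreducible p) :
    Irreducible ((shiftPoly τ a ^ l) p) :=
  (MulEquiv.irreducible_iff (shiftPoly τ a ^ l : K[X] ≃+* K[X])).2 hp

end zpow

namespace IsSigmaMonomial

variable {K L : Type*} [Field K] [Field L] [Algebra K L] {σ : L ≃+* L} {τ : K ≃+* K} {t : L}
  {a : K} (h : IsSigmaMonomial σ τ t a)
include h

/-- The shift orbits of irreducible polynomials are infinite. -/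
lemma eq_zero_of_shiftPoly_zpow_eq {q : K[X]} (hq : Irreducible q) {l : ℤ}
    (hl : (shiftPoly τ a ^ l) q = q) : l = 0 := by
  have key : ∀ n : ℕ, (shiftPoly τ a ^ n) q = q → n = 0 := by
    intro n hn
    by_contra hn0
    -- If `q` had period `n`, the product over one period would be invariant, hence a constant of
    -- the field, although `q` divides it.
    set P : K[X] := ∏ i ∈ Finset.range n, (shiftPoly τ a ^ i) q with hP
    have hPσ : shiftPoly τ a P = P := by
      rw [hP, map_prod]
      have h1 : ∀ i, shiftPoly τ a ((shiftPoly τ a ^ i) q) = (shiftPoly τ a ^ (i + 1)) q :=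
        fun i => by rw [pow_succ', RingAut.mul_apply]
      simp only [h1]
      obtain ⟨m, rfl⟩ := Nat.exists_eq_succ_of_ne_zero hn0
      rw [Finset.prod_range_succ, hn, Finset.prod_range_succ', pow_zero]
      rfl
    obtain ⟨c, hc⟩ := h.const (aeval t P) (by rw [← h.aeval_shiftPoly, hPσ])
    have hPc : P = C c := h.aeval_injective (by rw [← hc, aeval_C])
    have hdvd : q ∣ P := by
      have := Finset.dvd_prod_of_mem (fun i => (shiftPoly τ a ^ i) q)
        (Finset.mem_range.2 (Nat.pos_of_ne_zero hn0))
      rwa [pow_zero, RingAut.one_apply] at this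
    have hP0 : P ≠ 0 := Finset.prod_ne_zero_iff.2 fun i _ =>
      (map_ne_zero_iff _ (RingEquiv.injective (shiftPoly τ a ^ i))).2 hq.ne_zero
    have := natDegree_le_of_dvd hdvd hP0
    rw [hPc, natDegree_C] at this
    have := hq.natDegree_pos
    omega
  rcases Int.le_total 0 l with h0 | h0
  · lift l to ℕ using h0
    rw [zpow_natCast] at hl
    exact_mod_cast key l hl
  · obtain ⟨n, rfl⟩ : ∃ n : ℕ, l = -n := ⟨(-l).toNat, by omega⟩
    have : (shiftPoly τ a ^ n) q = q := by
      conv_lhs => rw [← hl]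
      rw [← zpow_natCast, ← RingAut.mul_apply, ← zpow_add]
      simp
    simp [key n this]

lemma regularAt_map_iff {q : K[X]} {f : L} :
    RegularAt t (shiftPoly τ a q) (σ f) ↔ RegularAt t q f := by
  constructor
  · rintro ⟨c', d', hd, hf⟩
    obtain ⟨c, rfl⟩ := (shiftPoly τ a).surjective c'
    obtain ⟨d, rfl⟩ := (shiftPoly τ a).surjective d'
    rw [h.aeval_shiftPoly, h.aeval_shiftPoly, ← map_div₀] at hf
    rw [shiftPoly_dvd_shiftPoly] at hd
    exact ⟨c, d, hd, σ.injective hf⟩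
  · rintro ⟨c, d, hd, rfl⟩
    rw [← shiftPoly_dvd_shiftPoly τ a] at hd
    refine ⟨shiftPoly τ a c, shiftPoly τ a d, hd, ?_⟩
    rw [h.aeval_shiftPoly, h.aeval_shiftPoly, map_div₀]

/-- The poles of a rational function form a finite set, hence each shift orbit leaves it. -/
lemma exists_last_pole {c d : K[X]} (hd : d ≠ 0) {q : K[X]} (hqm : q.Monic) (hqi : Irreducible q)
    (hq : ¬ RegularAt t q (aeval t c / aeval t d)) (e : ℤ) (he : e ≠ 0) :
    ∃ m : ℕ, ¬ RegularAt t ((shiftPoly τ a ^ (e * m)) q) (aeval t c / aeval t d) ∧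
      RegularAt t ((shiftPoly τ a ^ (e * (m + 1))) q) (aeval t c / aeval t d) := by
  by_contra hcon
  push Not at hcon
  have hall : ∀ m : ℕ, ¬ RegularAt t ((shiftPoly τ a ^ (e * m)) q) (aeval t c / aeval t d) := by
    intro m
    induction m with
    | zero => simpa using hq
    | succ m ih => exact_mod_cast hcon m ih
  have hdvd : ∀ m : ℕ, (shiftPoly τ a ^ (e * m)) q ∣ d := fun m => by
    by_contra hnd
    exact hall m ⟨c, d, hnd, rfl⟩
  classical
  -- If the poles never stopped, infinitely many distinct monic irreducible polynomials would divide
  -- `d`.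
  have hinj : Function.Injective fun m : ℕ => (shiftPoly τ a ^ (e * m)) q := by
    intro m n hmn
    have h1 : (shiftPoly τ a ^ (e * m - e * n)) q = q := by
      have hmn' : (shiftPoly τ a ^ (e * m)) q = (shiftPoly τ a ^ (e * n)) q := hmn
      rw [sub_eq_neg_add, zpow_add, RingAut.mul_apply, hmn', ← RingAut.mul_apply, ← zpow_add]
      simp
    have h2 := h.eq_zero_of_shiftPoly_zpow_eq hqi h1
    have h3 : e * ((m : ℤ) - n) = 0 := by linear_combination h2
    rcases mul_eq_zero.1 h3 with h4 | h4
    · exact absurd h4 he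
    · omega
  refine Set.infinite_range_of_injective hinj
    ((UniqueFactorizationMonoid.normalizedFactors d).toFinset.finite_toSet.subset ?_)
  rintro _ ⟨m, rfl⟩
  have hm := monic_shiftPoly_zpow τ a (e * m) hqm
  simp only [Finset.mem_coe, Multiset.mem_toFinset]
  rw [UniqueFactorizationMonoid.mem_normalizedFactors_iff' hd]
  exact ⟨irreducible_shiftPoly_zpow τ a _ hqi, hm.normalize_eq_self, hdvd m⟩

/-- A rational function whose difference has poles only in a set of representatives of the shift
classes is a polynomial. -/
theorem exists_aeval_eq_of_regularAt_sub {S : Set K[X]}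
    (hS : ∀ p ∈ S, ∀ l : ℤ, (shiftPoly τ a ^ l) p ∈ S → (shiftPoly τ a ^ l) p = p)
    {c d : K[X]} (hd : d ≠ 0)
    (hreg : ∀ q : K[X], q.Monic → Irreducible q → q ∉ S →
      RegularAt t q (σ (aeval t c / aeval t d) - aeval t c / aeval t d)) :
    ∃ p : K[X], aeval t p = aeval t c / aeval t d := by
  refine exists_aeval_eq_of_regularAt h.transcendental hd fun q hqm hqi => ?_
  by_contra hq
  set f := aeval t c / aeval t d with hf
  set s := shiftPoly τ a
  obtain ⟨m, hm1, hm2⟩ := h.exists_last_pole hd hqm hqi hq 1 one_ne_zero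
  obtain ⟨n, hn1, hn2⟩ := h.exists_last_pole hd hqm hqi hq (-1) (by norm_num)
  rw [← hf] at hm1 hm2 hn1 hn2
  have hstep : ∀ l : ℤ, s ((s ^ l) q) = (s ^ (l + 1)) q := fun l => by
    rw [add_comm, zpow_add, zpow_one, RingAut.mul_apply]
  have hpr : ∀ l : ℤ, Prime ((s ^ l) q) := fun l => (irreducible_shiftPoly_zpow τ a l hqi).prime
  -- One step beyond the last pole of `f` in the forward direction, `σ f` has a pole and `f` has
  -- none, so `σ f - f` has a pole.
  have hA : (s ^ ((m : ℤ) + 1)) q ∈ S := by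
    by_contra hnot
    refine hm1 (h.regularAt_map_iff.1 ?_)
    rw [one_mul, hstep]
    have h1 := hreg _ (monic_shiftPoly_zpow τ a _ hqm) (irreducible_shiftPoly_zpow τ a _ hqi) hnot
    rw [one_mul] at hm2
    simpa using h1.add h.transcendental (hpr _) hm2
  -- At the last pole of `f` in the backward direction, `f` has a pole and `σ f` has none. This
  -- gives a second member of `S` in the same orbit, at distance `m + 1 + n > 0`.
  have hB : (s ^ (-(n : ℤ))) q ∈ S := by
    by_contra hnot
    apply hn1
    rw [neg_one_mul]
    have h1 := hreg _ (monic_shiftPoly_zpow τ a _ hqm) (irreducible_shiftPoly_zpow τ a _ hqi) hnot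
    have h2 := h.regularAt_map_iff.2 hn2
    rw [hstep, show (-1 : ℤ) * (n + 1) + 1 = -n by ring] at h2
    simpa using h2.sub h.transcendental (hpr _) h1
  have hAB := hS _ hB ((m : ℤ) + 1 + n) (by
    rw [← RingAut.mul_apply, ← zpow_add]
    simpa using hA)
  have := h.eq_zero_of_shiftPoly_zpow_eq (irreducible_shiftPoly_zpow τ a _ hqi) hAB
  omega

end IsSigmaMonomial

/-! ### Partial fractions -/

/-- The powers of `t` and the elements `t^k / q^j` with `q` monic irreducible, `k < deg q` and
`1 ≤ j`. -/
def partialFractionSet (K : Type*) {L : Type*} [Field K] [Field L] [Algebra K L] (t : L) : Set L :=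
  {x | (∃ k : ℕ, x = t ^ k) ∨
    ∃ (q : K[X]) (k j : ℕ), q.Monic ∧ Irreducible q ∧ k < q.natDegree ∧ 1 ≤ j ∧
      x = t ^ k / aeval t q ^ j}

/-- The index type of the partial fraction basis. -/
abbrev PartialFractionIndex (K : Type*) [Field K] : Type _ :=
  ℕ ⊕ (Σ q : {q : K[X] // q.Monic ∧ Irreducible q}, ℕ × Fin q.1.natDegree)

/-- The partial fraction basis as a family. -/
def partialFraction (K : Type*) {L : Type*} [Field K] [Field L] [Algebra K L] (t : L) :
    PartialFractionIndex K → L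
  | .inl k => t ^ k
  | .inr x => t ^ (x.2.2 : ℕ) * (aeval t x.1.1)⁻¹ ^ (x.2.1 + 1)

section PartialFraction

variable {K L : Type*} [Field K] [Field L] [Algebra K L] {t : L}

lemma range_partialFraction : Set.range (partialFraction K t) = partialFractionSet K t := by
  ext x
  constructor
  · rintro ⟨k | ⟨⟨q, hq⟩, j, k⟩, rfl⟩
    · exact Or.inl ⟨k, rfl⟩
    · refine Or.inr ⟨q, k, j + 1, hq.1, hq.2, k.2, by omega, ?_⟩
      simp only [partialFraction]
      rw [inv_pow, div_eq_mul_inv]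
  · rintro (⟨k, rfl⟩ | ⟨q, k, j, hqm, hqi, hk, hj, rfl⟩)
    · exact ⟨.inl k, rfl⟩
    · refine ⟨.inr ⟨⟨q, hqm, hqi⟩, j - 1, ⟨k, hk⟩⟩, ?_⟩
      simp only [partialFraction]
      rw [inv_pow, div_eq_mul_inv, Nat.sub_add_cancel hj]

lemma isCoprime_of_monic_irreducible {p q : K[X]} (hp : p.Monic ∧ Irreducible p)
    (hq : q.Monic ∧ Irreducible q) (hpq : p ≠ q) : IsCoprime p q :=
  (EuclideanDomain.dvd_or_coprime p q hp.2).resolve_left fun hd =>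
    hpq (eq_of_monic_of_associated hp.1 hq.1 (hp.2.associated_of_dvd hq.2 hd))

lemma degree_sum_fin_lt_of_natDegree_eq {n : ℕ} (f : Fin n → K) {q : K[X]} (hq : q ≠ 0)
    (hn : n = q.natDegree) : (∑ k : Fin n, C (f k) * X ^ (k : ℕ)).degree < q.degree := by
  rw [degree_eq_natDegree hq, ← hn]
  exact degree_sum_fin_lt f

/-- Grouping a finite relation by `q` and by the exponent of `q` turns it into a partial fraction
expansion of `0`. Such expansions are unique, and the coefficients of the relation are the
polynomial coefficients of their parts. -/
theorem linearIndependent_partialFraction (ht : Transcendental K t) :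
    LinearIndependent K (partialFraction K t) := by
  classical
  let _ : Algebra K[X] L := (aeval t : K[X] →ₐ[K] L).toAlgebra
  have hinj : Function.Injective (algebraMap K[X] L) := transcendental_iff_injective.1 ht
  have : FaithfulSMul K[X] L := (faithfulSMul_iff_algebraMap_injective K[X] L).2 hinj
  -- The bounds `M`, `N` and the finite set `S` below enclose the support of a relation in a box, so
  -- that it can be written as an iterated sum with a common exponent bound.
  rw [linearIndependent_iff]
  intro c hc
  obtain ⟨M, hM⟩ : ∃ M : ℕ, ∀ x ∈ c.support, ∀ k, x = Sum.inl k → k < M := by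
    refine ⟨c.support.sup (fun x => x.elim id fun _ => 0) + 1, fun x hx k hxk => ?_⟩
    have := Finset.le_sup (f := fun x : PartialFractionIndex K => x.elim id fun _ => 0) hx
    rw [hxk] at this
    exact Nat.lt_succ_of_le this
  obtain ⟨N, hN⟩ : ∃ N : ℕ, ∀ x ∈ c.support, ∀ y, x = Sum.inr y → y.2.1 < N := by
    refine ⟨c.support.sup (fun x => x.elim (fun _ => 0) fun y => y.2.1) + 1, fun x hx y hxy => ?_⟩
    have := Finset.le_sup
      (f := fun x : PartialFractionIndex K => x.elim (fun _ => 0) fun y => y.2.1) hx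
    rw [hxy] at this
    exact Nat.lt_succ_of_le this
  obtain ⟨S, hS⟩ : ∃ S : Finset {q : K[X] // q.Monic ∧ Irreducible q},
      ∀ x ∈ c.support, ∀ y, x = Sum.inr y → y.1 ∈ S := by
    refine ⟨c.support.toRight.image Sigma.fst, fun x hx y hxy => ?_⟩
    exact Finset.mem_image_of_mem _ (by simpa [hxy] using hx)
  have hsub : c.support ⊆ (Finset.range M).disjSum
      (S.sigma fun q => Finset.range N ×ˢ (Finset.univ : Finset (Fin q.1.natDegree))) := by
    rintro (k | y) hx
    · simpa using hM _ hx k rfl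
    · have h1 := hS _ hx y rfl
      have h2 := hN _ hx y rfl
      simp [h1, h2]
  set P : K[X] := ∑ k ∈ Finset.range M, C (c (.inl k)) * X ^ k with hP
  set r : (q : {q : K[X] // q.Monic ∧ Irreducible q}) → Fin N → K[X] := fun q j =>
    ∑ k : Fin q.1.natDegree, C (c (.inr ⟨q, (j : ℕ), k⟩)) * X ^ (k : ℕ) with hr
  have hsum : algebraMap K[X] L P + ∑ q ∈ S, ∑ j : Fin N,
      algebraMap K[X] L (r q j) * (aeval t q.1)⁻¹ ^ (j.1 + 1) = 0 := by
    rw [← hc, Finsupp.linearCombination_apply, Finsupp.sum_of_support_subset c hsub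
      (fun x y => y • partialFraction K t x) (fun _ _ => zero_smul _ _), Finset.sum_disjSum,
      Finset.sum_sigma]
    congr 1
    · rw [hP, map_sum]
      refine Finset.sum_congr rfl fun k _ => ?_
      change aeval t _ = _
      rw [map_mul, map_pow, aeval_C, aeval_X, Algebra.smul_def]
      rfl
    · refine Finset.sum_congr rfl fun q _ => ?_
      rw [Finset.sum_product, ← Fin.sum_univ_eq_sum_range
        (fun j => ∑ k : Fin q.1.natDegree, c (.inr ⟨q, j, k⟩) • partialFraction K t (.inr ⟨q, j, k⟩))]
      refine Finset.sum_congr rfl fun j _ => ?_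
      rw [hr, map_sum, Finset.sum_mul]
      refine Finset.sum_congr rfl fun k _ => ?_
      change aeval t _ * _ = _
      rw [map_mul, map_pow, aeval_C, aeval_X, Algebra.smul_def, mul_assoc]
      rfl
  have huniq := quo_add_sum_rem_mul_pow_inverse_unique (R := K) (K := L) (s := S)
    (g := fun q => q.1) (n := fun _ => N) (gi := fun q => (aeval t q.1)⁻¹)
    (q₁ := P) (q₂ := 0) (r₁ := r) (r₂ := fun _ _ => 0)
    (fun q _ => q.2.1) (fun p _ q _ hpq =>
      isCoprime_of_monic_irreducible p.2 q.2 fun h => hpq (Subtype.ext h))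
    (fun q _ => inv_mul_cancel₀ (aeval_ne_zero_of_transcendental ht q.2.2.ne_zero))
    (fun q _ j => degree_sum_fin_lt_of_natDegree_eq _ q.2.2.ne_zero rfl)
    (fun q _ j => by
      rw [degree_zero]
      exact bot_lt_iff_ne_bot.2 (degree_ne_bot.2 q.2.2.ne_zero))
    (by rw [hsum]; simp)
  ext x
  by_contra hx
  have hxs : x ∈ c.support := Finsupp.mem_support_iff.2 hx
  rcases x with k | ⟨q, j, k⟩
  · apply hx
    have h1 := congrArg (fun p => coeff p k) huniq.1
    simpa [hP, finsetSum_coeff, coeff_C_mul_X_pow, hM _ hxs k rfl] using h1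
  · apply hx
    have h1 := congrArg (fun p => coeff p (k : ℕ))
      (congrFun (huniq.2 q (hS _ hxs _ rfl)) ⟨j, hN _ hxs _ rfl⟩)
    simpa [hr, finsetSum_coeff, coeff_C_mul_X_pow, Fin.val_inj] using h1

theorem linearIndepOn_partialFractionSet (ht : Transcendental K t) :
    LinearIndepOn K id (partialFractionSet K t) := by
  rw [← range_partialFraction]
  exact (linearIndependent_partialFraction ht).linearIndepOn_id

lemma aeval_mem_span_partialFractionSet (p : K[X]) :
    aeval t p ∈ Submodule.span K (partialFractionSet K t) := by
  rw [aeval_eq_sum_range]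
  exact Submodule.sum_mem _ fun k _ =>
    Submodule.smul_mem _ _ (Submodule.subset_span (Or.inl ⟨k, rfl⟩))

/-- Up to a unit, which is moved to the numerator, the denominator is a product of powers of
distinct monic irreducible polynomials. These are pairwise coprime, so the partial fraction
expansion applies. -/
theorem div_mem_span_partialFractionSet (ht : Transcendental K t) (a : K[X]) {b : K[X]}
    (hb : b ≠ 0) :
    aeval t a / aeval t b ∈ Submodule.span K (partialFractionSet K t) := by
  classical
  let _ : Algebra K[X] L := (aeval t : K[X] →ₐ[K] L).toAlgebra
  obtain ⟨m, hm⟩ : ∃ m, m = UniqueFactorizationMonoid.normalizedFactors b := ⟨_, rfl⟩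
  have hmem : ∀ q ∈ m, q.Monic ∧ Irreducible q := fun q hq => by
    rw [hm, UniqueFactorizationMonoid.mem_normalizedFactors_iff' hb] at hq
    exact ⟨by rw [← hq.2.1]; exact monic_normalize hq.1.ne_zero, hq.1⟩
  have hbm : Associated m.prod b := by
    rw [hm]
    exact UniqueFactorizationMonoid.prod_normalizedFactors hb
  obtain ⟨u, hu⟩ := hbm
  have hmne : m.prod ≠ 0 := by
    intro h0
    rw [h0, zero_mul] at hu
    exact hb hu.symm
  have hab : aeval t a / aeval t b = aeval t (a * (↑u⁻¹ : K[X])) / aeval t m.prod := by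
    rw [div_eq_div_iff (aeval_ne_zero_of_transcendental ht hb)
      (aeval_ne_zero_of_transcendental ht hmne), ← map_mul, ← map_mul, ← hu]
    congr 1
    rw [mul_assoc a, mul_comm m.prod, Units.inv_mul_cancel_left]
  have hinv : ∀ q ∈ m.toFinset, (aeval t q)⁻¹ * algebraMap K[X] L q = 1 := fun q hq =>
    inv_mul_cancel₀ (aeval_ne_zero_of_transcendental ht
      (hmem q (Multiset.mem_toFinset.1 hq)).2.ne_zero)
  have hmon : ∀ q ∈ m.toFinset, q.Monic := fun q hq => (hmem q (Multiset.mem_toFinset.1 hq)).1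
  have hcop : Set.Pairwise (m.toFinset : Set K[X]) fun p q => IsCoprime p q := by
    intro p hp q hq hpq
    rw [Finset.mem_coe, Multiset.mem_toFinset] at hp hq
    exact isCoprime_of_monic_irreducible (hmem p hp) (hmem q hq) hpq
  obtain ⟨n, hn⟩ : ∃ n : K[X] → ℕ, ∀ q, n q = m.count q := ⟨_, fun _ => rfl⟩
  obtain ⟨Q, r, hr, hQ⟩ := mul_prod_pow_inverse_eq_quo_add_sum_rem_mul_pow_inverse (K := L)
    (s := m.toFinset) (a * (↑u⁻¹ : K[X])) (g := fun q => q)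
    hmon hcop n (gi := fun q => (aeval t q)⁻¹) hinv
  have hprod : ∏ q ∈ m.toFinset, (aeval t q)⁻¹ ^ n q = (aeval t m.prod)⁻¹ := by
    rw [Finset.prod_multiset_count m, map_prod, ← Finset.prod_inv_distrib]
    refine Finset.prod_congr rfl fun q _ => ?_
    rw [map_pow, inv_pow, hn]
  rw [hab, div_eq_mul_inv, ← hprod]
  change algebraMap K[X] L _ * _ ∈ _
  rw [hQ]
  refine Submodule.add_mem _ (aeval_mem_span_partialFractionSet Q)
    (Submodule.sum_mem _ fun q hq => Submodule.sum_mem _ fun j _ => ?_)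
  have hq' := hmem q (Multiset.mem_toFinset.1 hq)
  change aeval t (r q j) * _ ∈ _
  rw [aeval_eq_sum_range, Finset.sum_mul]
  refine Submodule.sum_mem _ fun k hk => ?_
  rw [smul_mul_assoc]
  refine Submodule.smul_mem _ _ (Submodule.subset_span (Or.inr ⟨q, k, j + 1, hq'.1, hq'.2, ?_,
    by omega, by rw [inv_pow, div_eq_mul_inv]⟩))
  have h2 := hr q hq j
  have h3 : (r q j).natDegree < q.natDegree := by
    rcases eq_or_ne (r q j) 0 with h0 | h0
    · rw [h0, natDegree_zero]
      exact hq'.2.natDegree_pos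
    · exact natDegree_lt_natDegree h0 h2
  rw [Finset.mem_range] at hk
  omega

theorem span_partialFractionSet (ht : Transcendental K t) :
    Submodule.span K (partialFractionSet K t) =
      Subalgebra.toSubmodule (IntermediateField.adjoin K {t}).toSubalgebra := by
  apply le_antisymm
  · rw [Submodule.span_le]
    have htm : t ∈ IntermediateField.adjoin K {t} := IntermediateField.mem_adjoin_simple_self K t
    have hp : ∀ p : K[X], aeval t p ∈ IntermediateField.adjoin K {t} := fun p =>
      (IntermediateField.mem_adjoin_simple_iff K _).2 ⟨p, 1, by simp⟩
    rintro x (⟨k, rfl⟩ | ⟨q, k, j, -, -, -, -, rfl⟩)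
    all_goals change _ ∈ IntermediateField.adjoin K {t}
    · exact pow_mem htm k
    · exact div_mem (pow_mem htm k) (pow_mem (hp q) j)
  · intro x hx
    obtain ⟨r, s, rfl⟩ := (IntermediateField.mem_adjoin_simple_iff K x).1 hx
    by_cases hs : s = 0
    · simp [hs]
    · exact div_mem_span_partialFractionSet ht r hs

end PartialFraction

/-! ### The fields `F_i` and the rings `E_i` -/

namespace SigmaTower

variable {F₀ : Type u} {L : Type v} [Field F₀] [Field L] [Algebra F₀ L] {n : ℕ}
  (T : SigmaTower F₀ L n)

lemma Δ_apply (f : L) : T.Δ f = T.σ f - f := rfl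

lemma towerField_mono {i j : ℕ} (h : i ≤ j) : towerField F₀ T.t i ≤ towerField F₀ T.t j :=
  IntermediateField.adjoin.mono _ _ _ (Set.image_mono fun _ hk => lt_of_lt_of_le hk h)

lemma towerRing_mono {i j : ℕ} (h : i ≤ j) : towerRing F₀ T.t i ≤ towerRing F₀ T.t j :=
  Algebra.adjoin_mono (Set.image_mono fun _ hk => lt_of_lt_of_le hk h)

lemma gen_mem_towerField {i j : ℕ} (h : i < j) : T.t i ∈ towerField F₀ T.t j :=
  IntermediateField.subset_adjoin _ _ ⟨i, h, rfl⟩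

lemma gen_mem_towerRing {i j : ℕ} (h : i < j) : T.t i ∈ towerRing F₀ T.t j :=
  Algebra.subset_adjoin ⟨i, h, rfl⟩

lemma towerRing_le_towerField (i : ℕ) :
    towerRing F₀ T.t i ≤ (towerField F₀ T.t i).toSubalgebra :=
  fun _ hx => IntermediateField.algebra_adjoin_le_adjoin F₀ _ hx

lemma towerField_succ (i : ℕ) :
    towerField F₀ T.t (i + 1) =
      (IntermediateField.adjoin (towerField F₀ T.t i) {T.t i}).restrictScalars F₀ := by
  rw [towerField, towerField, IntermediateField.adjoin_adjoin_left]
  congr 1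
  ext x
  constructor
  · rintro ⟨j, hj, rfl⟩
    rcases Nat.lt_succ_iff_lt_or_eq.1 hj with h | rfl
    · exact Or.inl ⟨j, h, rfl⟩
    · exact Or.inr rfl
  · rintro (⟨j, hj, rfl⟩ | rfl)
    · exact ⟨j, Nat.lt_succ_of_lt hj, rfl⟩
    · exact ⟨i, Nat.lt_succ_self i, rfl⟩

lemma mem_towerField_succ {i : ℕ} {x : L} :
    x ∈ towerField F₀ T.t (i + 1) ↔ x ∈ IntermediateField.adjoin (towerField F₀ T.t i) {T.t i} := by
  rw [towerField_succ, IntermediateField.mem_restrictScalars]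

lemma aeval_mem_towerField_succ {i : ℕ} (p : (towerField F₀ T.t i)[X]) :
    aeval (T.t i) p ∈ towerField F₀ T.t (i + 1) :=
  T.mem_towerField_succ.2 ((IntermediateField.mem_adjoin_simple_iff _ _).2 ⟨p, 1, by simp⟩)

lemma exists_div_of_mem_towerField_succ {i : ℕ} {x : L} (hx : x ∈ towerField F₀ T.t (i + 1)) :
    ∃ a b : (towerField F₀ T.t i)[X], b ≠ 0 ∧ x = aeval (T.t i) a / aeval (T.t i) b := by
  obtain ⟨a, b, rfl⟩ := (IntermediateField.mem_adjoin_simple_iff _ _).1 (T.mem_towerField_succ.1 hx)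
  by_cases hb : b = 0
  · exact ⟨0, 1, one_ne_zero, by simp [hb]⟩
  · exact ⟨a, b, hb, rfl⟩

/-- Elements of `E_{i+1}` are represented by polynomials over the field `F_i` with a condition on
the coefficients. This lets the arguments for `F_i[t]` be used unchanged for the rings. -/
lemma mem_towerRing_succ {i : ℕ} {x : L} :
    x ∈ towerRing F₀ T.t (i + 1) ↔ ∃ p : (towerField F₀ T.t i)[X],
      (∀ k, (p.coeff k : L) ∈ towerRing F₀ T.t i) ∧ aeval (T.t i) p = x := by
  constructor
  · intro hx
    refine Algebra.adjoin_induction (p := fun x _ => ∃ p : (towerField F₀ T.t i)[X],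
      (∀ k, (p.coeff k : L) ∈ towerRing F₀ T.t i) ∧ aeval (T.t i) p = x) ?_ ?_ ?_ ?_ hx
    · rintro _ ⟨j, hj, rfl⟩
      rcases Nat.lt_succ_iff_lt_or_eq.1 hj with h | rfl
      · refine ⟨Polynomial.C ⟨T.t j, T.gen_mem_towerField h⟩, fun k => ?_, by simp⟩
        rw [coeff_C]
        split_ifs
        · exact T.gen_mem_towerRing h
        · exact zero_mem _
      · refine ⟨X, fun k => ?_, by simp⟩
        rw [coeff_X]
        split_ifs
        · exact one_mem _
        · exact zero_mem _
    · intro r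
      refine ⟨Polynomial.C (algebraMap F₀ _ r), fun k => ?_, by
        rw [aeval_C, ← IsScalarTower.algebraMap_apply]⟩
      rw [coeff_C]
      split_ifs
      · exact (towerRing F₀ T.t i).algebraMap_mem r
      · exact zero_mem _
    · rintro _ _ _ _ ⟨p, hp, rfl⟩ ⟨q, hq, rfl⟩
      refine ⟨p + q, fun k => ?_, map_add _ _ _⟩
      rw [coeff_add]
      exact add_mem (hp k) (hq k)
    · rintro _ _ _ _ ⟨p, hp, rfl⟩ ⟨q, hq, rfl⟩
      refine ⟨p * q, fun k => ?_, map_mul _ _ _⟩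
      rw [coeff_mul, AddSubmonoidClass.coe_finsetSum]
      exact sum_mem fun x _ => mul_mem (hp _) (hq _)
  · rintro ⟨p, hp, rfl⟩
    rw [aeval_eq_sum_range]
    refine sum_mem fun k _ => ?_
    rw [Algebra.smul_def]
    exact mul_mem (T.towerRing_mono (Nat.le_succ i) (hp k))
      (pow_mem (T.gen_mem_towerRing (Nat.lt_succ_self i)) k)

/-! ### The shift on the fields of the tower -/

/-- Stability under the inverse is needed for `σ` to restrict to an automorphism of `F_i`. Both
statements are proved in one induction, using `σ t = t + Δ t` and `σ⁻¹ t = t - σ⁻¹(Δ t)`. -/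
lemma σ_mem_towerField_aux {i : ℕ} (hi : i ≤ n) :
    (∀ x ∈ towerField F₀ T.t i, T.σ x ∈ towerField F₀ T.t i) ∧
      ∀ x ∈ towerField F₀ T.t i, T.σ.symm x ∈ towerField F₀ T.t i := by
  have hsymm : ∀ a, T.σ.symm (algebraMap F₀ L a) = algebraMap F₀ L (T.σ₀.symm a) := fun a => by
    rw [RingEquiv.symm_apply_eq, T.σ_algebraMap, RingEquiv.apply_symm_apply]
  induction i with
  | zero =>
    have h0 : ∀ x, x ∈ towerField F₀ T.t 0 ↔ ∃ a : F₀, algebraMap F₀ L a = x :=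
      T.mem_fieldSpace_zero
    constructor
    · intro x hx
      obtain ⟨a, rfl⟩ := (h0 x).1 hx
      exact (h0 _).2 ⟨T.σ₀ a, (T.σ_algebraMap a).symm⟩
    · intro x hx
      obtain ⟨a, rfl⟩ := (h0 x).1 hx
      exact (h0 _).2 ⟨T.σ₀.symm a, (hsymm a).symm⟩
  | succ i ih =>
    obtain ⟨ih1, ih2⟩ := ih (Nat.le_of_succ_le hi)
    have hmono := T.towerField_mono (Nat.le_succ i)
    have ht := T.gen_mem_towerField (Nat.lt_succ_self i)
    have hd := T.diff_mem i hi
    constructor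
    · intro x hx
      refine IntermediateField.adjoin_induction F₀
        (p := fun x _ => T.σ x ∈ towerField F₀ T.t (i + 1)) ?_ ?_ ?_ ?_ ?_ hx
      · rintro _ ⟨j, hj, rfl⟩
        rcases Nat.lt_succ_iff_lt_or_eq.1 hj with h | rfl
        · exact hmono (ih1 _ (T.gen_mem_towerField h))
        · have := add_mem (hmono hd) ht
          rwa [sub_add_cancel] at this
      · intro r
        rw [T.σ_algebraMap]
        exact IntermediateField.algebraMap_mem _ _
      · intro x y _ _ hx hy
        rw [map_add]; exact add_mem hx hy
      · intro x _ hx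
        rw [map_inv₀]; exact inv_mem hx
      · intro x y _ _ hx hy
        rw [map_mul]; exact mul_mem hx hy
    · intro x hx
      refine IntermediateField.adjoin_induction F₀
        (p := fun x _ => T.σ.symm x ∈ towerField F₀ T.t (i + 1)) ?_ ?_ ?_ ?_ ?_ hx
      · rintro _ ⟨j, hj, rfl⟩
        rcases Nat.lt_succ_iff_lt_or_eq.1 hj with h | rfl
        · exact hmono (ih2 _ (T.gen_mem_towerField h))
        · have := sub_mem ht (hmono (ih2 _ hd))
          rwa [map_sub, RingEquiv.symm_apply_apply, sub_sub_cancel] at this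
      · intro r
        rw [hsymm]
        exact IntermediateField.algebraMap_mem _ _
      · intro x y _ _ hx hy
        rw [map_add]; exact add_mem hx hy
      · intro x _ hx
        rw [map_inv₀]; exact inv_mem hx
      · intro x y _ _ hx hy
        rw [map_mul]; exact mul_mem hx hy

lemma σ_mem_towerField {i : ℕ} (hi : i ≤ n) {x : L} (hx : x ∈ towerField F₀ T.t i) :
    T.σ x ∈ towerField F₀ T.t i := (T.σ_mem_towerField_aux hi).1 x hx

lemma σ_symm_mem_towerField {i : ℕ} (hi : i ≤ n) {x : L} (hx : x ∈ towerField F₀ T.t i) :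
    T.σ.symm x ∈ towerField F₀ T.t i := (T.σ_mem_towerField_aux hi).2 x hx

lemma σ_zpow_mem_towerField {i : ℕ} (hi : i ≤ n) (l : ℤ) {x : L}
    (hx : x ∈ towerField F₀ T.t i) : (T.σ ^ l) x ∈ towerField F₀ T.t i := by
  induction l using Int.induction_on generalizing x with
  | zero => simpa using hx
  | succ m ih =>
    rw [zpow_add_one, RingAut.mul_apply]
    exact ih (T.σ_mem_towerField hi hx)
  | pred m ih =>
    rw [zpow_sub_one, RingAut.mul_apply, RingAut.inv_apply]
    exact ih (T.σ_symm_mem_towerField hi hx)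

lemma Δ_mem_fieldSpace {i : ℕ} (hi : i ≤ n) {x : L} (hx : x ∈ T.fieldSpace i) :
    T.Δ x ∈ T.fieldSpace i :=
  sub_mem (H := towerField F₀ T.t i) (T.σ_mem_towerField hi hx) hx

lemma σ_mem_towerRing (hT : T.IsRingTower) {i : ℕ} (hi : i ≤ n) {x : L}
    (hx : x ∈ towerRing F₀ T.t i) : T.σ x ∈ towerRing F₀ T.t i := by
  refine Algebra.adjoin_induction (p := fun x _ => T.σ x ∈ towerRing F₀ T.t i) ?_ ?_ ?_ ?_ hx
  · rintro _ ⟨j, hj, rfl⟩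
    have hj' : j < i := hj
    have h1 : T.σ (T.t j) - T.t j ∈ towerRing F₀ T.t j := hT j (hj'.trans_le hi)
    have := add_mem (T.towerRing_mono hj'.le h1) (T.gen_mem_towerRing hj')
    rwa [sub_add_cancel] at this
  · intro r
    rw [T.σ_algebraMap]
    exact Subalgebra.algebraMap_mem _ _
  · intro x y _ _ hx hy
    rw [map_add]; exact add_mem hx hy
  · intro x y _ _ hx hy
    rw [map_mul]; exact mul_mem hx hy

lemma Δ_mem_ringSpace (hT : T.IsRingTower) {i : ℕ} (hi : i ≤ n) {x : L}
    (hx : x ∈ T.ringSpace i) : T.Δ x ∈ T.ringSpace i :=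
  sub_mem (H := towerRing F₀ T.t i) (T.σ_mem_towerRing hT hi hx) hx

/-- The restriction of `σ` to `F_i`. -/
def σField (i : ℕ) (hi : i ≤ n) : towerField F₀ T.t i ≃+* towerField F₀ T.t i where
  toFun x := ⟨T.σ x, T.σ_mem_towerField hi x.2⟩
  invFun x := ⟨T.σ.symm x, T.σ_symm_mem_towerField hi x.2⟩
  left_inv x := Subtype.ext (T.σ.symm_apply_apply x)
  right_inv x := Subtype.ext (T.σ.apply_symm_apply x)
  map_mul' x y := Subtype.ext (map_mul T.σ (x : L) y)
  map_add' x y := Subtype.ext (map_add T.σ (x : L) y)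

lemma isSigmaMonomial (i : ℕ) (hi : i < n) :
    IsSigmaMonomial T.σ (T.σField i hi.le) (T.t i)
      (⟨T.Δ (T.t i), T.diff_mem i hi⟩ : towerField F₀ T.t i) where
  transcendental := T.transcendental i hi
  map_algebraMap _ := rfl
  map_gen := (add_sub_cancel (T.t i) (T.σ (T.t i))).symm
  const x hx := by
    obtain ⟨c, rfl⟩ := T.const_eq x hx
    exact ⟨algebraMap F₀ _ c, rfl⟩

lemma σ_coe_C (c : T.C) : T.σ (algebraMap F₀ L (c : F₀)) = algebraMap F₀ L (c : F₀) := by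
  rw [T.σ_algebraMap]
  exact congrArg _ c.2

lemma smul_eq (c : T.C) (x : L) : c • x = algebraMap F₀ L (c : F₀) * x :=
  Algebra.smul_def (c : F₀) x

lemma exists_C_of_σ_eq {x : L} (hx : T.σ x = x) :
    ∃ c : T.C, algebraMap F₀ L (c : F₀) = x := by
  obtain ⟨c, rfl⟩ := T.const_eq x hx
  refine ⟨⟨c, ?_⟩, rfl⟩
  rw [T.σ_algebraMap] at hx
  exact (algebraMap F₀ L).injective hx

/-! ### The canonical basis -/

lemma canonicalStep_eq (i : ℕ) :
    T.canonicalStep i = partialFractionSet (towerField F₀ T.t i) (T.t i) := rfl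

lemma canonicalStep_subset (i : ℕ) {η : L} (hη : η ∈ T.canonicalStep i) :
    η ∈ towerField F₀ T.t (i + 1) := by
  have ht := T.gen_mem_towerField (Nat.lt_succ_self i)
  rcases hη with ⟨k, rfl⟩ | ⟨q, k, j, -, -, -, -, rfl⟩
  · exact pow_mem ht k
  · exact div_mem (pow_mem ht k) (pow_mem (T.aeval_mem_towerField_succ q) j)

lemma canonicalBasis_subset (Θ₀ : Set F₀) (i : ℕ) {ξ : L} (hξ : ξ ∈ T.canonicalBasis Θ₀ i) :
    ξ ∈ towerField F₀ T.t i := by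
  induction i generalizing ξ with
  | zero =>
    obtain ⟨a, -, rfl⟩ := hξ
    exact IntermediateField.algebraMap_mem _ _
  | succ i ih =>
    obtain ⟨ξ, hξ, η, hη, rfl⟩ := hξ
    exact mul_mem (T.towerField_mono (Nat.le_succ i) (ih hξ)) (T.canonicalStep_subset i hη)

lemma canonicalBasis_subset_succ (Θ₀ : Set F₀) (i : ℕ) :
    T.canonicalBasis Θ₀ i ⊆ T.canonicalBasis Θ₀ (i + 1) := fun ξ hξ =>
  ⟨ξ, hξ, 1, Or.inl ⟨0, (pow_zero _).symm⟩, (mul_one ξ).symm⟩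

lemma canonicalBasis_mono (Θ₀ : Set F₀) : Monotone (T.canonicalBasis Θ₀) :=
  monotone_nat_of_le_succ (T.canonicalBasis_subset_succ Θ₀)

/-- The canonical basis of `F_{i+1}` as the family of products of basis elements. -/
lemma canonicalBasis_product (Θ₀ : Set F₀) {i : ℕ} (hi : i < n)
    (h : LinearIndepOn T.C id (T.canonicalBasis Θ₀ i)) :
    LinearIndependent T.C
      (fun p : T.canonicalBasis Θ₀ i × T.canonicalStep i => (p.1 : L) * (p.2 : L)) := by
  have h1 : LinearIndependent T.C (fun ξ : T.canonicalBasis Θ₀ i =>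
      (⟨ξ, T.canonicalBasis_subset Θ₀ i ξ.2⟩ : towerField F₀ T.t i)) :=
    LinearIndependent.of_comp ((towerField F₀ T.t i).val.toLinearMap.restrictScalars T.C) h
  have h2 : LinearIndependent (towerField F₀ T.t i) (fun η : T.canonicalStep i => (η : L)) :=
    linearIndepOn_partialFractionSet (T.transcendental i hi)
  have h3 := linearIndependent_smul h1 h2
  have h4 : (fun p : T.canonicalBasis Θ₀ i × T.canonicalStep i => (p.1 : L) * (p.2 : L)) =
    fun p => (⟨p.1, T.canonicalBasis_subset Θ₀ i p.1.2⟩ : towerField F₀ T.t i) • (p.2 : L) := rfl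
  rw [h4]
  exact h3

lemma linearIndepOn_canonicalBasis {ι : Type w} (b : Module.Basis ι T.C F₀) {i : ℕ} (hi : i ≤ n) :
    LinearIndepOn T.C id (T.canonicalBasis (Set.range b) i) := by
  induction i with
  | zero =>
    have h : LinearIndependent T.C (fun k => algebraMap F₀ L (b k)) :=
      b.linearIndependent.map' ((Algebra.linearMap F₀ L).restrictScalars T.C)
        (LinearMap.ker_eq_bot.2 (algebraMap F₀ L).injective)
    have h2 := h.linearIndepOn_id
    rwa [Set.range_comp' (algebraMap F₀ L) b] at h2
  | succ i ih =>
    have h2 := (T.canonicalBasis_product _ hi (ih (Nat.le_of_succ_le hi))).linearIndepOn_id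
    convert h2 using 1
    ext x
    constructor
    · rintro ⟨ξ, hξ, η, hη, rfl⟩
      exact ⟨(⟨ξ, hξ⟩, ⟨η, hη⟩), rfl⟩
    · rintro ⟨⟨ξ, η⟩, rfl⟩
      exact ⟨ξ, ξ.2, η, η.2, rfl⟩

lemma span_canonicalBasis {ι : Type w} (b : Module.Basis ι T.C F₀) {i : ℕ} (hi : i ≤ n) :
    Submodule.span T.C (T.canonicalBasis (Set.range b) i) = T.fieldSpace i := by
  refine le_antisymm (Submodule.span_le.2 fun ξ hξ => T.canonicalBasis_subset _ i hξ) ?_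
  induction i with
  | zero =>
    intro x hx
    obtain ⟨a, rfl⟩ := (T.mem_fieldSpace_zero x).1 hx
    have ha : a ∈ Submodule.span T.C (Set.range b) := by rw [b.span_eq]; trivial
    have := Submodule.mem_map_of_mem (f := (Algebra.linearMap F₀ L).restrictScalars T.C) ha
    rwa [Submodule.map_span] at this
  | succ i ih =>
    have key : ∀ η ∈ T.canonicalStep i, ∀ c ∈ T.fieldSpace i,
        c * η ∈ Submodule.span T.C (T.canonicalBasis (Set.range b) (i + 1)) := by
      intro η hη c hc
      have hc' := ih (Nat.le_of_succ_le hi) hc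
      clear hc
      induction hc' using Submodule.span_induction with
      | mem ξ hξ => exact Submodule.subset_span ⟨ξ, hξ, η, hη, rfl⟩
      | zero => rw [zero_mul]; exact zero_mem _
      | add x y hx hy ihx ihy => rw [add_mul]; exact add_mem ihx ihy
      | smul d x hx ihx => rw [smul_mul_assoc]; exact Submodule.smul_mem _ _ ihx
    intro x hx
    have hx' : x ∈ Submodule.span (towerField F₀ T.t i) (T.canonicalStep i) := by
      rw [canonicalStep_eq, span_partialFractionSet (T.transcendental i hi)]
      exact T.mem_towerField_succ.1 hx
    clear hx
    -- The target is only a `C`-space while the span is over `F_i`; carrying a factor `c ∈ F_i`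
    -- through the induction absorbs the scalars.
    suffices ∀ c ∈ T.fieldSpace i,
        c * x ∈ Submodule.span T.C (T.canonicalBasis (Set.range b) (i + 1)) by
      simpa using this 1 (one_mem (towerField F₀ T.t i))
    induction hx' using Submodule.span_induction with
    | mem η hη => exact key η hη
    | zero => intro c _; rw [mul_zero]; exact zero_mem _
    | add x y _ _ ihx ihy =>
      intro c hc
      rw [mul_add]
      exact add_mem (ihx c hc) (ihy c hc)
    | smul d x _ ihx =>
      intro c hc
      have := ihx (c * (d : L)) (mul_mem (S := IntermediateField F₀ L) hc d.2)
      rwa [mul_assoc] at this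

end SigmaTower

/-! ### Coordinate functionals -/

/-- Extending `B` to a basis of `V` supplies a functional with the required values, so the default
`0` in the definition is not taken. -/
lemma coordFunctional_spec {C : Type u} {V : Type v} [Field C] [AddCommGroup V] [Module C V]
    {B : Set V} (hB : LinearIndepOn C id B) {θ : V} (hθ : θ ∈ B) :
    coordFunctional (C := C) B θ θ = 1 ∧
      ∀ ξ ∈ B, ξ ≠ θ → coordFunctional (C := C) B θ ξ = 0 := by
  have hex : ∃ l : V →ₗ[C] C, l θ = 1 ∧ ∀ ξ ∈ B, ξ ≠ θ → l ξ = 0 := by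
    let e := Module.Basis.extend hB
    have hsub : B ⊆ hB.extend (Set.subset_univ B) := hB.subset_extend _
    have he : ∀ ξ (hξ : ξ ∈ B), e ⟨ξ, hsub hξ⟩ = ξ := fun ξ hξ =>
      Module.Basis.extend_apply_self hB ⟨ξ, hsub hξ⟩
    refine ⟨e.coord ⟨θ, hsub hθ⟩, ?_, fun ξ hξ hne => ?_⟩
    · have h1 := e.repr_self ⟨θ, hsub hθ⟩
      rw [he θ hθ] at h1
      rw [Module.Basis.coord_apply, h1, Finsupp.single_eq_same]
    · have h1 := e.repr_self ⟨ξ, hsub hξ⟩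
      rw [he ξ hξ] at h1
      rw [Module.Basis.coord_apply, h1, Finsupp.single_eq_of_ne]
      exact fun h => hne (congrArg Subtype.val h).symm
  rw [coordFunctional, dif_pos hex]
  exact hex.choose_spec

lemma mem_summableSpace {C : Type u} {L : Type v} [Field C] [AddCommGroup L] [Module C L]
    {Δ : L →ₗ[C] L} {V : Submodule C L} {f : V} :
    f ∈ summableSpace Δ V ↔ ∃ g ∈ V, Δ g = f :=
  Iff.rfl

/-- A complete reduction is idempotent. -/
lemma IsCompleteReduction.apply_apply {C : Type u} {V : Type v} [Field C] [AddCommGroup V]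
    [Module C V] {U : Submodule C V} {φ : V →ₗ[C] V} (h : IsCompleteReduction U φ) (f : V) :
    φ (φ f) = φ f := by
  have h1 : f - φ f ∈ LinearMap.ker φ := h.ker_eq ▸ h.sub_mem f
  rw [LinearMap.mem_ker, map_sub, sub_eq_zero] at h1
  exact h1.symm

lemma IsCompleteReduction.apply_eq_zero_iff {C : Type u} {V : Type v} [Field C] [AddCommGroup V]
    [Module C V] {U : Submodule C V} {φ : V →ₗ[C] V} (h : IsCompleteReduction U φ) {f : V} :
    φ f = 0 ↔ f ∈ U := by
  rw [← LinearMap.mem_ker, h.ker_eq]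

namespace SigmaTower

variable {F₀ : Type u} {L : Type v} [Field F₀] [Field L] [Algebra F₀ L] {n : ℕ}
  (T : SigmaTower F₀ L n)

section Coord

variable {ι : Type w} (b : Module.Basis ι T.C F₀) {i : ℕ} (hi : i ≤ n)
include hi

lemma canonicalCoord_spec {θ : T.fieldSpace i}
    (hθ : (θ : L) ∈ T.canonicalBasis (Set.range b) i) :
    T.canonicalCoord (Set.range b) i θ θ = 1 ∧
      ∀ ξ : T.fieldSpace i, (ξ : L) ∈ T.canonicalBasis (Set.range b) i → ξ ≠ θ →
        T.canonicalCoord (Set.range b) i θ ξ = 0 := by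
  refine coordFunctional_spec ?_ hθ
  have h := T.linearIndepOn_canonicalBasis b hi
  have hmap : Function.Injective
      (fun ξ : {ξ : T.fieldSpace i | (ξ : L) ∈ T.canonicalBasis (Set.range b) i} =>
        (⟨ξ.1, ξ.2⟩ : T.canonicalBasis (Set.range b) i)) := fun x y hxy =>
    Subtype.ext (Subtype.ext (congrArg (fun z : T.canonicalBasis (Set.range b) i => (z : L)) hxy))
  exact LinearIndependent.of_comp (T.fieldSpace i).subtype (LinearIndependent.comp h _ hmap)

/-- Two linear functionals that agree on the canonical basis agree. -/
lemma eq_of_eqOn_canonicalBasis {M : Type*} [AddCommGroup M] [Module T.C M]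
    {l l' : T.fieldSpace i →ₗ[T.C] M}
    (h : ∀ ξ : T.fieldSpace i, (ξ : L) ∈ T.canonicalBasis (Set.range b) i → l ξ = l' ξ) :
    l = l' := by
  refine LinearMap.ext_on (s := {ξ : T.fieldSpace i | (ξ : L) ∈ T.canonicalBasis (Set.range b) i}) ?_ h
  have hspan := T.span_canonicalBasis b hi
  apply Submodule.map_injective_of_injective (f := (T.fieldSpace i).subtype)
    (Submodule.injective_subtype _)
  have himage : (T.fieldSpace i).subtype ''
      {ξ : T.fieldSpace i | (ξ : L) ∈ T.canonicalBasis (Set.range b) i} =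
        T.canonicalBasis (Set.range b) i := by
    ext x
    constructor
    · rintro ⟨ξ, hξ, rfl⟩
      exact hξ
    · intro hx
      exact ⟨⟨x, T.canonicalBasis_subset _ i hx⟩, hx, rfl⟩
  rw [Submodule.map_span, Submodule.map_top, Submodule.range_subtype, himage, hspan]

/-- Let `m` be the indicator of `f`. The canonical bases are nested, so `f` expands in the basis of
`F_m`. If every element that occurs had indicator below `m`, then `f` would lie in `F_{m-1}`, or be
`0` when `m = 0`. -/
lemma exists_canonicalCoord_ne_zero {f : T.fieldSpace i} (hf : f ≠ 0) :
    ∃ θ : T.fieldSpace i, (θ : L) ∈ T.canonicalBasis (Set.range b) i ∧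
      T.canonicalCoord (Set.range b) i θ f ≠ 0 ∧ T.indicator θ = T.indicator f := by
  classical
  set m := T.indicator f with hm
  have hmem : ∀ x : T.fieldSpace i, (x : L) ∈ T.fieldSpace (T.indicator x) := fun x =>
    Nat.sInf_mem (s := {j | (x : L) ∈ T.fieldSpace j}) ⟨i, x.2⟩
  have hle : ∀ {x : L} {j : ℕ}, x ∈ T.fieldSpace j → T.indicator x ≤ j := fun hx =>
    Nat.sInf_le hx
  have hmi : m ≤ i := hle f.2
  by_contra hcon
  push Not at hcon
  have hfm : (f : L) ∈ Submodule.span T.C (T.canonicalBasis (Set.range b) m) := by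
    rw [T.span_canonicalBasis b (hmi.trans hi)]
    exact hmem f
  have hlow : (f : L) ∈ Submodule.span T.C
      {ξ | ξ ∈ T.canonicalBasis (Set.range b) m ∧ T.indicator ξ < m} := by
    obtain ⟨c, hcs, hc⟩ := Submodule.mem_span_set.1 hfm
    rw [← hc]
    refine Submodule.sum_mem _ fun ξ hξ => ?_
    have hξm := hcs hξ
    have hξi := T.canonicalBasis_mono (Set.range b) hmi hξm
    set θ : T.fieldSpace i := ⟨ξ, T.canonicalBasis_subset _ i hξi⟩ with hθ
    have hspec := T.canonicalCoord_spec b hi (θ := θ) hξi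
    have hcoord : T.canonicalCoord (Set.range b) i θ f = c ξ := by
      have hfsum : f = c.support.attach.sum fun x => c x.1 • (⟨x.1, T.canonicalBasis_subset _ i
          (T.canonicalBasis_mono (Set.range b) hmi (hcs x.2))⟩ : T.fieldSpace i) := by
        apply Subtype.ext
        rw [← hc, AddSubmonoidClass.coe_finsetSum, Finsupp.sum,
          ← Finset.sum_attach c.support]
        rfl
      rw [hfsum, map_sum, Finset.sum_eq_single ⟨ξ, hξ⟩]
      · rw [map_smul]
        change c ξ • T.canonicalCoord (Set.range b) i θ θ = _
        rw [hspec.1, smul_eq_mul, mul_one]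
      · intro x _ hx
        rw [map_smul, hspec.2 _ (T.canonicalBasis_mono (Set.range b) hmi (hcs x.2)), smul_zero]
        exact fun h => hx (Subtype.ext (congrArg (fun z : T.fieldSpace i => (z : L)) h))
      · intro h
        exact absurd (Finset.mem_attach _ _) h
    have hne : T.indicator ξ ≠ m := hcon θ hξi (by
      rw [hcoord]
      exact Finsupp.mem_support_iff.1 hξ)
    exact Submodule.smul_mem _ _ (Submodule.subset_span
      ⟨hξm, lt_of_le_of_ne (hle (T.canonicalBasis_subset _ m hξm)) hne⟩)
  rcases Nat.eq_zero_or_pos m with h0 | hpos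
  · have : {ξ | ξ ∈ T.canonicalBasis (Set.range b) m ∧ T.indicator ξ < m} = ∅ := by
      ext ξ
      simp [h0]
    rw [this, Submodule.span_empty, Submodule.mem_bot] at hlow
    exact hf (Subtype.ext hlow)
  · have hsub : Submodule.span T.C
        {ξ | ξ ∈ T.canonicalBasis (Set.range b) m ∧ T.indicator ξ < m} ≤ T.fieldSpace (m - 1) := by
      refine Submodule.span_le.2 fun ξ hξ => ?_
      have h1 : ξ ∈ T.fieldSpace (T.indicator ξ) :=
        Nat.sInf_mem (s := {j | ξ ∈ T.fieldSpace j}) ⟨m, T.canonicalBasis_subset _ m hξ.1⟩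
      exact T.towerField_mono (by have := hξ.2; omega) h1
    have := hle (hsub hlow)
    omega

end Coord

/-! ### One step of the tower -/

/-- The elements of `im φ ∩ ker l`, as an additive subgroup of the field `F_i`. -/
def stepGroup (i : ℕ) (l : T.fieldSpace i →ₗ[T.C] T.C)
    (φ : T.fieldSpace i →ₗ[T.C] T.fieldSpace i) : AddSubgroup (towerField F₀ T.t i) where
  carrier := {x | ∃ y ∈ LinearMap.range φ ⊓ LinearMap.ker l, (y : L) = x}
  zero_mem' := ⟨0, zero_mem _, rfl⟩
  add_mem' := by
    rintro _ _ ⟨y, hy, h⟩ ⟨z, hz, h'⟩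
    exact ⟨y + z, add_mem hy hz, congrArg₂ (· + ·) h h'⟩
  neg_mem' := by
    rintro _ ⟨y, hy, h⟩
    exact ⟨-y, neg_mem hy, congrArg Neg.neg h⟩

section Step

variable {i : ℕ} (hi : i < n) {S : Set L} {l : T.fieldSpace i →ₗ[T.C] T.C}
  {φ : T.fieldSpace i →ₗ[T.C] T.fieldSpace i}

lemma mem_polyComplement_iff {x : L} :
    x ∈ T.polyComplement i l φ ↔ ∃ r : (towerField F₀ T.t i)[X],
      (∀ k, r.coeff k ∈ T.stepGroup i l φ) ∧ aeval (T.t i) r = x := by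
  constructor
  · intro hx
    induction hx using Submodule.span_induction with
    | mem x hx =>
      obtain ⟨a, ha, k, rfl⟩ := hx
      refine ⟨Polynomial.C (⟨a, a.2⟩ : towerField F₀ T.t i) * X ^ k, fun m => ?_, ?_⟩
      · rw [coeff_C_mul_X_pow]
        split_ifs
        · exact ⟨a, ha, rfl⟩
        · exact zero_mem _
      · rw [map_mul, map_pow, aeval_C, aeval_X]
        rfl
    | zero => exact ⟨0, fun k => by simp [zero_mem], map_zero _⟩
    | add x y _ _ hx hy =>
      obtain ⟨r, hr, rfl⟩ := hx
      obtain ⟨s, hs, rfl⟩ := hy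
      exact ⟨r + s, fun k => by rw [coeff_add]; exact add_mem (hr k) (hs k), map_add _ _ _⟩
    | smul c x _ hx =>
      obtain ⟨r, hr, rfl⟩ := hx
      refine ⟨Polynomial.C (algebraMap F₀ (towerField F₀ T.t i) c) * r, fun k => ?_, ?_⟩
      · obtain ⟨y, hy, h⟩ := hr k
        refine ⟨c • y, Submodule.smul_mem _ c hy, ?_⟩
        rw [coeff_C_mul]
        change c • (y : L) = _
        rw [smul_eq, h]
        rfl
      · rw [map_mul, aeval_C, smul_eq]
        rfl
  · rintro ⟨r, hr, rfl⟩
    rw [aeval_eq_sum_range]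
    refine Submodule.sum_mem _ fun k _ => ?_
    obtain ⟨y, hy, h⟩ := hr k
    refine Submodule.subset_span ⟨y, hy, k, ?_⟩
    rw [Algebra.smul_def, h]
    rfl

/-- The polynomials that represent the elements of `S`. -/
def polySet (i : ℕ) (S : Set L) : Set (towerField F₀ T.t i)[X] := {p | aeval (T.t i) p ∈ S}

/-- Both polynomials represent the class of `p`, and representatives are unique. -/
lemma polySet_rigid (hi : i < n) (hS : T.IsRepresentatives i S) {p : (towerField F₀ T.t i)[X]}
    (hp : p ∈ T.polySet i S) (l : ℤ)
    (hl : (shiftPoly (T.σField i hi.le) ⟨T.Δ (T.t i), T.diff_mem i hi⟩ ^ l) p ∈ T.polySet i S) :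
    (shiftPoly (T.σField i hi.le) ⟨T.Δ (T.t i), T.diff_mem i hi⟩ ^ l) p = p := by
  have h := T.isSigmaMonomial i hi
  obtain ⟨q, -, hq⟩ := hS.2 _ (hS.1 hp)
  apply h.aeval_injective
  rw [hq _ ⟨hp, 1, one_mem (towerField F₀ T.t i), one_ne_zero, 0, by simp⟩]
  exact hq _ ⟨hl, 1, one_mem (towerField F₀ T.t i), one_ne_zero, l, by
    rw [one_mul, h.aeval_shiftPoly_zpow]⟩

/-- The elements of the proper part of the complement are proper fractions whose denominators are
products of elements of `S`. -/
lemma exists_of_mem_properComplement (hi : i < n) {x : L}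
    (hx : x ∈ T.properComplement i S) :
    ∃ a b : (towerField F₀ T.t i)[X], a.degree < b.degree ∧ aeval (T.t i) b ∈ Submonoid.closure S ∧
      x = aeval (T.t i) a / aeval (T.t i) b := by
  have h := T.isSigmaMonomial i hi
  have hne : ∀ {p : (towerField F₀ T.t i)[X]} {q : (towerField F₀ T.t i)[X]},
      p.degree < q.degree → q ≠ 0 := fun h0 hq => by simp [hq] at h0
  induction hx using Submodule.span_induction with
  | mem x hx => exact hx
  | zero =>
    exact ⟨0, 1, by simp, by rw [map_one]; exact one_mem _, by simp⟩
  | add x y _ _ hx hy =>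
    obtain ⟨a, b, hab, hb, rfl⟩ := hx
    obtain ⟨c, d, hcd, hd, rfl⟩ := hy
    have hb0 := hne hab
    have hd0 := hne hcd
    refine ⟨a * d + b * c, b * d, ?_, by rw [map_mul]; exact mul_mem hb hd, ?_⟩
    · refine (degree_add_le _ _).trans_lt (max_lt ?_ ?_)
      · rw [degree_mul, degree_mul]
        exact WithBot.add_lt_add_right (degree_ne_bot.2 hd0) hab
      · rw [degree_mul, degree_mul]
        exact WithBot.add_lt_add_left (degree_ne_bot.2 hb0) hcd
    · rw [div_add_div _ _ (h.aeval_ne_zero hb0) (h.aeval_ne_zero hd0), map_add, map_mul, map_mul,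
        map_mul]
  | smul c x _ hx =>
    obtain ⟨a, b, hab, hb, rfl⟩ := hx
    refine ⟨Polynomial.C (algebraMap F₀ _ (c : F₀)) * a, b,
      by
      rw [← smul_eq_C_mul]
      exact (degree_smul_le _ _).trans_lt hab, hb, ?_⟩
    rw [smul_eq, map_mul, aeval_C, mul_div_assoc]
    rfl

/-- A monic prime dividing a product of monic irreducible elements of `S` equals one of them. Hence
elements of `U_S` have poles only in `S`. -/
lemma regularAt_of_mem_closure (hi : i < n) (hS : T.IsRepresentatives i S)
    {q : (towerField F₀ T.t i)[X]} (hqm : q.Monic) (hqi : Irreducible q) (hq : q ∉ T.polySet i S)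
    {b : (towerField F₀ T.t i)[X]} (hb : aeval (T.t i) b ∈ Submonoid.closure S) : ¬ q ∣ b := by
  have h := T.isSigmaMonomial i hi
  suffices ∀ x ∈ Submonoid.closure S, ∃ b : (towerField F₀ T.t i)[X],
      aeval (T.t i) b = x ∧ ¬ q ∣ b by
    obtain ⟨b', hb', hqb⟩ := this _ hb
    rwa [h.aeval_injective hb'] at hqb
  intro x hx
  induction hx using Submonoid.closure_induction with
  | mem x hx =>
    obtain ⟨p, hpm, hpi, rfl⟩ := hS.1 hx
    refine ⟨p, rfl, fun hd => hq ?_⟩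
    have := eq_of_monic_of_associated hqm hpm (hqi.associated_of_dvd hpi hd)
    rw [this]
    exact hx
  | one => exact ⟨1, map_one _, fun hd => hqi.not_isUnit (isUnit_of_dvd_one hd)⟩
  | mul x y _ _ hx hy =>
    obtain ⟨c, rfl, hc⟩ := hx
    obtain ⟨d, rfl, hd⟩ := hy
    exact ⟨c * d, map_mul _ _ _, fun h0 => (hqi.prime.dvd_or_dvd h0).elim hc hd⟩

end Step

end SigmaTower

/-! ### The decomposition of `F_{i+1}` into the complement and the summable space -/

namespace SigmaTower

variable {F₀ : Type u} {L : Type v} [Field F₀] [Field L] [Algebra F₀ L] {n : ℕ}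
  (T : SigmaTower F₀ L n)

section Step

variable {i : ℕ} (hi : i < n) {S : Set L} {l : T.fieldSpace i →ₗ[T.C] T.C}
  {φ : T.fieldSpace i →ₗ[T.C] T.fieldSpace i}

/-- Polynomials over a subalgebra of `F_i` that is stable under `φ` and the associated summation
are summable modulo `V_θ`, within this subalgebra. -/
theorem exists_poly_reduction [CharZero F₀]
    (hl : l (φ (T.diffGen i hi)) ≠ 0) {A : Subalgebra F₀ L}
    (hAσ : ∀ x ∈ A, T.σ x ∈ A) (hAt : T.Δ (T.t i) ∈ A)
    (hA : ∀ f : T.fieldSpace i, (f : L) ∈ A →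
      (φ f : L) ∈ A ∧ ∃ g ∈ T.fieldSpace i, g ∈ A ∧ T.Δ g = f - φ f)
    (p : (towerField F₀ T.t i)[X]) (hp : ∀ k, (p.coeff k : L) ∈ A) :
    ∃ g r : (towerField F₀ T.t i)[X], (∀ k, (g.coeff k : L) ∈ A) ∧ (∀ k, (r.coeff k : L) ∈ A) ∧
      (∀ k, r.coeff k ∈ T.stepGroup i l φ) ∧
      aeval (T.t i) p = T.Δ (aeval (T.t i) g) + aeval (T.t i) r := by
  have : CharZero (towerField F₀ T.t i) :=
    charZero_of_injective_algebraMap (algebraMap F₀ (towerField F₀ T.t i)).injective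
  have h := T.isSigmaMonomial i hi
  set a : towerField F₀ T.t i := ⟨T.Δ (T.t i), T.diff_mem i hi⟩ with ha
  have hC : ∀ c : T.C, algebraMap F₀ L (c : F₀) ∈ A := fun c => A.algebraMap_mem _
  obtain ⟨g, r, hg, hr, hrW, heq⟩ := exists_eq_shiftPoly_sub_add (T.σField i hi.le) a
    (R := A.toSubring.comap (algebraMap (towerField F₀ T.t i) L)) (W := T.stepGroup i l φ)
    (fun x hx => hAσ x hx) hAt
    (fun m => by
      change (((m : towerField F₀ T.t i)⁻¹ : towerField F₀ T.t i) : L) ∈ A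
      have : (((m : towerField F₀ T.t i)⁻¹ : towerField F₀ T.t i) : L) =
          algebraMap F₀ L ((m : F₀)⁻¹) := by simp
      rw [this]
      exact A.algebraMap_mem _)
    (fun c' hc => by
      let c : T.fieldSpace i := c'
      obtain ⟨haA, e, heF, heA, he⟩ := hA (T.diffGen i hi) hAt
      obtain ⟨hcA, g, hgF, hgA, hg⟩ := hA c hc
      -- With this constant, `z = φ c - lam • φ a` lies in `im φ ∩ ker l`. From `c = Δ g + φ c` and
      -- `a = Δ e + φ a` one gets `c = Δ(g - lam e) + lam a + z`.
      set lam : T.C := l (φ c) / l (φ (T.diffGen i hi)) with hlam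
      set z : T.fieldSpace i := φ c - lam • φ (T.diffGen i hi) with hz
      have hlamK : algebraMap F₀ L (lam : F₀) ∈ towerField F₀ T.t i :=
        IntermediateField.algebraMap_mem _ _
      refine ⟨(⟨g - algebraMap F₀ L (lam : F₀) * e, sub_mem hgF (mul_mem hlamK heF)⟩ : towerField F₀ T.t i),
        sub_mem (H := A) hgA (mul_mem (hC _) heA),
        ⟨algebraMap F₀ L (lam : F₀), hlamK⟩, hC lam, ⟨z, z.2⟩, ?_, ⟨z, ⟨?_, ?_⟩, rfl⟩,
        Subtype.ext (T.σ_coe_C lam), Subtype.ext ?_⟩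
      · change ((φ c : L) - lam • (φ (T.diffGen i hi) : L)) ∈ A
        rw [smul_eq]
        exact sub_mem hcA (mul_mem (hC _) haA)
      · exact ⟨(c : T.fieldSpace i) - lam • T.diffGen i hi, by rw [map_sub, map_smul]⟩
      · change l z = 0
        rw [hz, map_sub, map_smul, smul_eq_mul, hlam, div_mul_cancel₀ _ hl, sub_self]
      · change (c : L) = (T.σ (g - algebraMap F₀ L (lam : F₀) * e) -
          (g - algebraMap F₀ L (lam : F₀) * e)) + algebraMap F₀ L (lam : F₀) * T.Δ (T.t i) +
          ((φ c : L) - lam • (φ (T.diffGen i hi) : L))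
        have he' : T.σ e - e = T.Δ (T.t i) - (φ (T.diffGen i hi) : L) := he
        have hg' : T.σ g - g = c - φ c := hg
        rw [smul_eq, map_sub, map_mul, σ_coe_C]
        linear_combination (-1 : L) * hg' + algebraMap F₀ L (lam : F₀) * he')
    p hp
  refine ⟨g, r, hg, hr, hrW, ?_⟩
  rw [heq, map_add, map_sub, h.aeval_shiftPoly, Δ_apply]

/-- The only elements of `F_i[t]` whose difference lies in `V_θ` are the constants. -/
theorem Δ_aeval_eq_zero [CharZero F₀]
    (hφ : IsCompleteReduction (summableSpace T.Δ (T.fieldSpace i)) φ)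
    (hl : l (φ (T.diffGen i hi)) ≠ 0) (g r : (towerField F₀ T.t i)[X])
    (hr : ∀ k, r.coeff k ∈ T.stepGroup i l φ)
    (hgr : T.Δ (aeval (T.t i) g) = aeval (T.t i) r) : T.Δ (aeval (T.t i) g) = 0 := by
  have : CharZero (towerField F₀ T.t i) :=
    charZero_of_injective_algebraMap (algebraMap F₀ (towerField F₀ T.t i)).injective
  have h := T.isSigmaMonomial i hi
  set a : towerField F₀ T.t i := ⟨T.Δ (T.t i), T.diff_mem i hi⟩ with ha
  have heq : shiftPoly (T.σField i hi.le) a g - g = r := h.aeval_injective (by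
    rw [map_sub, h.aeval_shiftPoly, ← hgr, Δ_apply])
  have hconst := shiftPoly_eq_self_of_coeff_mem (T.σField i hi.le) a (W := T.stepGroup i l φ)
    (fun c lam hlam hW => by
      obtain ⟨d, hd⟩ := T.exists_C_of_σ_eq (congrArg Subtype.val hlam)
      obtain ⟨y, ⟨⟨z, hz⟩, hy⟩, hyeq⟩ := hW
      have hφy : φ y = y := by rw [← hz, hφ.apply_apply]
      set c' : T.fieldSpace i := c
      have hsum : (⟨T.Δ c, T.Δ_mem_fieldSpace hi.le c.2⟩ : T.fieldSpace i) ∈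
          summableSpace T.Δ (T.fieldSpace i) := mem_summableSpace.2 ⟨c, c.2, rfl⟩
      have hyd : y = ⟨T.Δ c, T.Δ_mem_fieldSpace hi.le c.2⟩ + d • T.diffGen i hi := by
        apply Subtype.ext
        rw [hyeq]
        change (T.σ c - c) + (lam : L) * T.Δ (T.t i) = (T.σ c - c) + d • T.Δ (T.t i)
        rw [smul_eq, hd]
      -- Applying `φ` fixes `y`, which lies in its image, and kills `Δ c`. Since `l y = 0` but `l (φ
      -- a) ≠ 0`, the constant `d` must vanish.
      have hyφ : y = d • φ (T.diffGen i hi) := by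
        conv_lhs => rw [← hφy, hyd]
        rw [map_add, hφ.apply_eq_zero_iff.2 hsum, zero_add, map_smul]
      have hd0 : d = 0 := by
        have hy' : l y = 0 := hy
        rw [hyφ, map_smul, smul_eq_mul] at hy'
        exact (mul_eq_zero.1 hy').resolve_right hl
      refine ⟨Subtype.ext ?_, Subtype.ext ?_⟩
      · rw [← hd, hd0]
        exact map_zero _
      · have hy0 : (y : L) = 0 := by rw [hyφ, hd0, zero_smul]; rfl
        have h1 : (y : L) = T.Δ c + d • T.Δ (T.t i) := congrArg Subtype.val hyd
        rw [hy0, hd0, zero_smul, add_zero, Δ_apply] at h1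
        exact sub_eq_zero.1 h1.symm)
    g (fun k => by rw [heq]; exact hr k)
  rw [Δ_apply, ← h.aeval_shiftPoly, hconst, sub_self]

lemma properComplement_le (hi : i < n) :
    T.properComplement i S ≤ T.fieldSpace (i + 1) := by
  intro x hx
  obtain ⟨a, b, -, -, rfl⟩ := T.exists_of_mem_properComplement hi hx
  exact div_mem (S := IntermediateField F₀ L) (T.aeval_mem_towerField_succ a)
    (T.aeval_mem_towerField_succ b)

lemma polyComplement_le : T.polyComplement i l φ ≤ T.fieldSpace (i + 1) := by
  intro x hx
  obtain ⟨r, -, rfl⟩ := T.mem_polyComplement_iff.1 hx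
  exact T.aeval_mem_towerField_succ r

/-- Telescoping: each step contributes the difference of an iterate of `x`, which stays in
`F_{i+1}`. -/
lemma zpow_sub_self_mem (hi : i < n) (m : ℤ) {x : L} (hx : x ∈ T.fieldSpace (i + 1)) :
    (T.σ ^ m) x - x ∈ (T.fieldSpace (i + 1)).map T.Δ := by
  have hΔ : ∀ y ∈ T.fieldSpace (i + 1), T.σ y - y ∈ (T.fieldSpace (i + 1)).map T.Δ :=
    fun y hy => ⟨y, hy, rfl⟩
  induction m using Int.induction_on with
  | zero => simp [zero_mem]
  | succ k ih =>
    have h1 := hΔ _ (T.σ_zpow_mem_towerField hi k hx)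
    have h2 := add_mem h1 ih
    rwa [sub_add_sub_cancel, ← RingAut.mul_apply, ← zpow_one_add, add_comm 1 (k : ℤ)] at h2
  | pred k ih =>
    have h1 := hΔ _ (T.σ_zpow_mem_towerField hi (-(k : ℤ) - 1) hx)
    have h2 := sub_mem ih h1
    rw [← RingAut.mul_apply, ← zpow_one_add, add_sub_cancel] at h2
    convert h2 using 1
    ring

/-- Shifting `q` to its representative costs only a summable term and preserves properness, because
the shift preserves degrees. -/
lemma mem_sup_of_proper (hi : i < n) (hS : T.IsRepresentatives i S)
    {q : (towerField F₀ T.t i)[X]} (hqm : q.Monic) (hqi : Irreducible q) (j : ℕ)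
    {a : (towerField F₀ T.t i)[X]} (ha : a.degree < (q ^ j).degree) :
    aeval (T.t i) a / aeval (T.t i) (q ^ j) ∈
      (T.fieldSpace (i + 1)).map T.Δ ⊔ T.properComplement i S := by
  have h := T.isSigmaMonomial i hi
  set s := shiftPoly (T.σField i hi.le) ⟨T.Δ (T.t i), T.diff_mem i hi⟩ with hs
  obtain ⟨p, ⟨hpS, c, hc, hc0, m, hpq⟩, -⟩ := hS.2 (aeval (T.t i) q) ⟨q, hqm, hqi, rfl⟩
  obtain ⟨P, hPm, hPi, rfl⟩ := hS.1 hpS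
  have hP : P = Polynomial.C (⟨c, hc⟩ : towerField F₀ T.t i) * (s ^ m) q := h.aeval_injective (by
    rw [map_mul, aeval_C, h.aeval_shiftPoly_zpow]
    exact hpq)
  have hsq : ((s ^ m) q).Monic := monic_shiftPoly_zpow _ _ m hqm
  -- Both polynomials are monic, so the factor `c` from shift equivalence is `1`.
  have hPs : P = (s ^ m) q := by
    have h1 := congrArg leadingCoeff hP
    rw [hPm.leadingCoeff, leadingCoeff_mul, leadingCoeff_C, hsq.leadingCoeff, mul_one] at h1
    rw [hP, ← h1, map_one, one_mul]
  set x := aeval (T.t i) a / aeval (T.t i) (q ^ j) with hx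
  have hxF : x ∈ T.fieldSpace (i + 1) :=
    div_mem (S := IntermediateField F₀ L) (T.aeval_mem_towerField_succ a)
      (T.aeval_mem_towerField_succ _)
  have hU : (T.σ ^ m) x ∈ T.properComplement i S := by
    refine Submodule.subset_span ⟨(s ^ m) a, P ^ j, ?_, ?_, ?_⟩
    · rw [hPs, ← map_pow, degree_shiftPoly_zpow, degree_shiftPoly_zpow]
      exact ha
    · rw [map_pow]
      exact pow_mem (Submonoid.subset_closure hpS) j
    · rw [hx, map_div₀, hPs, ← map_pow, h.aeval_shiftPoly_zpow, h.aeval_shiftPoly_zpow]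
  have h1 := T.zpow_sub_self_mem hi m hxF
  have h2 : x = -((T.σ ^ m) x - x) + (T.σ ^ m) x := by ring
  rw [h2]
  exact Submodule.add_mem_sup (neg_mem h1) hU

/-- On `F_i`-multiples of the partial fraction basis, powers of `t` are handled by the polynomial
reduction with `A = F_i`, and proper fractions by shifting their denominators. -/
lemma fieldSpace_succ_le_sup [CharZero F₀] (hS : T.IsRepresentatives i S)
    (hφ : IsCompleteReduction (summableSpace T.Δ (T.fieldSpace i)) φ)
    (hl : l (φ (T.diffGen i hi)) ≠ 0) :
    T.fieldSpace (i + 1) ≤ (T.fieldSpace (i + 1)).map T.Δ ⊔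
      (T.properComplement i S ⊔ T.polyComplement i l φ) := by
  intro x hx
  have hx' : x ∈ Submodule.span (towerField F₀ T.t i) (T.canonicalStep i) := by
    rw [canonicalStep_eq, span_partialFractionSet (T.transcendental i hi)]
    exact T.mem_towerField_succ.1 hx
  clear hx
  suffices ∀ c : towerField F₀ T.t i, (c : L) * x ∈ (T.fieldSpace (i + 1)).map T.Δ ⊔
      (T.properComplement i S ⊔ T.polyComplement i l φ) by
    simpa using this 1
  induction hx' using Submodule.span_induction with
  | mem η hη =>
    intro c
    rcases hη with ⟨k, rfl⟩ | ⟨q, k, j, hqm, hqi, hk, hj, rfl⟩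
    · obtain ⟨g, r, -, -, hr, heq⟩ := T.exists_poly_reduction hi hl
        (A := (towerField F₀ T.t i).toSubalgebra) (fun x hx => T.σ_mem_towerField hi.le hx)
        (T.diff_mem i hi) (fun f _ => ⟨(φ f).2, by
          obtain ⟨g, hg, h⟩ := mem_summableSpace.1 (hφ.sub_mem f)
          exact ⟨g, hg, hg, h⟩⟩)
        (Polynomial.C c * X ^ k) (fun m => SetLike.coe_mem _)
      rw [map_mul, map_pow, aeval_C, aeval_X] at heq
      change (c : L) * _ = _ at heq
      rw [heq]
      exact Submodule.add_mem_sup ⟨_, T.aeval_mem_towerField_succ g, rfl⟩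
        (Submodule.mem_sup_right (T.mem_polyComplement_iff.2 ⟨r, hr, rfl⟩))
    · have h1 := T.mem_sup_of_proper hi hS hqm hqi j (a := Polynomial.C c * X ^ k) (by
        refine (degree_C_mul_X_pow_le _ _).trans_lt ?_
        rw [degree_eq_natDegree (hqm.pow j).ne_zero, hqm.natDegree_pow, Nat.cast_lt]
        exact hk.trans_le (Nat.le_mul_of_pos_left _ hj))
      rw [map_mul, map_pow, map_pow, aeval_C, aeval_X, mul_div_assoc] at h1
      have hle : (T.fieldSpace (i + 1)).map T.Δ ⊔ T.properComplement i S ≤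
          (T.fieldSpace (i + 1)).map T.Δ ⊔ (T.properComplement i S ⊔ T.polyComplement i l φ) :=
        sup_le_sup_left le_sup_left _
      exact hle h1
  | zero => intro c; rw [mul_zero]; exact zero_mem _
  | add x y _ _ ihx ihy => intro c; rw [mul_add]; exact add_mem (ihx c) (ihy c)
  | smul d x _ ihx =>
    intro c
    have := ihx (c * d)
    rwa [MulMemClass.coe_mul, mul_assoc] at this

/-- The poles of `Δ f` lie in `S`, so `f` is a polynomial in `t`. Then the proper part of `Δ f` is
also a polynomial, hence `0`, and the polynomial case finishes. -/
lemma Δ_eq_zero_of_mem_complement [CharZero F₀] (hS : T.IsRepresentatives i S)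
    (hφ : IsCompleteReduction (summableSpace T.Δ (T.fieldSpace i)) φ)
    (hl : l (φ (T.diffGen i hi)) ≠ 0) {f : L} (hf : f ∈ T.fieldSpace (i + 1))
    (hΔ : T.Δ f ∈ T.properComplement i S ⊔ T.polyComplement i l φ) : T.Δ f = 0 := by
  have h := T.isSigmaMonomial i hi
  obtain ⟨u, hu, v, hv, huv⟩ := Submodule.mem_sup.1 hΔ
  obtain ⟨a, b, hab, hb, rfl⟩ := T.exists_of_mem_properComplement hi hu
  obtain ⟨r, hr, rfl⟩ := T.mem_polyComplement_iff.1 hv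
  obtain ⟨c, d, hd, rfl⟩ := T.exists_div_of_mem_towerField_succ hf
  obtain ⟨g, hg⟩ := h.exists_aeval_eq_of_regularAt_sub (S := T.polySet i S)
    (fun p hp m hm => T.polySet_rigid hi hS hp m hm) hd (c := c) (fun q hqm hqi hq => by
      have h1 : RegularAt (T.t i) q (aeval (T.t i) a / aeval (T.t i) b) :=
        ⟨a, b, T.regularAt_of_mem_closure hi hS hqm hqi hq hb, rfl⟩
      have h2 := h1.add h.transcendental hqi.prime (regularAt_aeval hqi.prime r)
      rw [huv] at h2
      exact h2)
  rw [← hg] at huv ⊢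
  have hb0 : b ≠ 0 := by
    rintro rfl
    simp at hab
  have hpoly : a = (shiftPoly (T.σField i hi.le) ⟨T.Δ (T.t i), T.diff_mem i hi⟩ g - g - r) * b := by
    apply h.aeval_injective
    rw [map_mul, map_sub, map_sub, h.aeval_shiftPoly, ← Δ_apply, ← huv, add_sub_cancel_right,
      div_mul_cancel₀ _ (h.aeval_ne_zero hb0)]
  have ha0 : a = 0 := by
    by_contra ha0
    have hdvd : b ∣ a := ⟨_, by rw [mul_comm]; exact hpoly⟩
    exact absurd (degree_le_of_dvd hdvd ha0) (not_le.2 hab)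
  rw [ha0, map_zero, zero_div, zero_add] at huv
  exact T.Δ_aeval_eq_zero hi hφ hl g r hr huv.symm

/-- `F_{i+1}` is the direct sum of `U_S ⊕ V_θ` and the summable space. -/
theorem isCompl_complement [CharZero F₀] (hS : T.IsRepresentatives i S)
    (hφ : IsCompleteReduction (summableSpace T.Δ (T.fieldSpace i)) φ)
    (hl : l (φ (T.diffGen i hi)) ≠ 0) :
    IsCompl (T.complement i S l φ) (summableSpace T.Δ (T.fieldSpace (i + 1))) := by
  constructor
  · rw [Submodule.disjoint_def]
    rintro x hx1 hx2
    obtain ⟨g, hg, hgx⟩ := mem_summableSpace.1 hx2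
    have hx1' : (x : L) ∈ T.properComplement i S ⊔ T.polyComplement i l φ := hx1
    rw [← hgx] at hx1'
    exact Subtype.ext (hgx ▸ T.Δ_eq_zero_of_mem_complement hi hS hφ hl hg hx1')
  · rw [codisjoint_iff, Submodule.eq_top_iff']
    intro x
    obtain ⟨d, hd, y, hy, hdy⟩ := Submodule.mem_sup.1 (T.fieldSpace_succ_le_sup hi hS hφ hl x.2)
    have hyF : y ∈ T.fieldSpace (i + 1) :=
      sup_le (T.properComplement_le hi) T.polyComplement_le hy
    have hdF : d ∈ T.fieldSpace (i + 1) := by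
      obtain ⟨g, hg, rfl⟩ := hd
      exact T.Δ_mem_fieldSpace hi hg
    have hx : x = ⟨y, hyF⟩ + ⟨d, hdF⟩ := Subtype.ext (by rw [← hdy, add_comm]; rfl)
    rw [hx]
    exact Submodule.add_mem_sup hy hd

end Step

end SigmaTower

/-! ### The complete reductions of the tower and the choice of the `θ_i` -/

namespace SigmaTower

variable {F₀ : Type u} {L : Type v} [Field F₀] [Field L] [Algebra F₀ L] {n : ℕ}
  (T : SigmaTower F₀ L n)

section ReductionStep

variable {i : ℕ} {S : Set L} {l : T.fieldSpace i →ₗ[T.C] T.C}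
  {φ : T.fieldSpace i →ₗ[T.C] T.fieldSpace i}
  (h : IsCompl (T.complement i S l φ) (summableSpace T.Δ (T.fieldSpace (i + 1))))
include h

lemma isCompleteReduction_reductionStep :
    IsCompleteReduction (summableSpace T.Δ (T.fieldSpace (i + 1))) (T.reductionStep i S l φ) := by
  rw [reductionStep, dif_pos h]
  exact ⟨fun f => Submodule.sub_projection_mem h f, Submodule.ker_projection h⟩

lemma reductionStep_eq {f r : T.fieldSpace (i + 1)} (hr : r ∈ T.complement i S l φ)
    (hfr : f - r ∈ summableSpace T.Δ (T.fieldSpace (i + 1))) :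
    T.reductionStep i S l φ f = r := by
  rw [reductionStep, dif_pos h]
  have h1 : f = r + (f - r) := (add_sub_cancel r f).symm
  rw [h1, map_add, Submodule.projection_apply_of_mem_left h hr,
    (Submodule.projection_apply_eq_zero_iff h).2 hfr, add_zero]

/-- The certificate used by the algorithm: a decomposition whose remainder has coefficients in `im φ
∩ ker l` determines the value of the projection, without reference to the elements of `S`. -/
lemma coe_reductionStep_eq_aeval {f : T.fieldSpace (i + 1)} {g : L} (hg : g ∈ T.fieldSpace (i + 1))
    {r : (towerField F₀ T.t i)[X]} (hr : ∀ k, r.coeff k ∈ T.stepGroup i l φ)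
    (hf : (f : L) = T.Δ g + aeval (T.t i) r) :
    (T.reductionStep i S l φ f : L) = aeval (T.t i) r := by
  rw [T.reductionStep_eq h (r := ⟨aeval (T.t i) r, T.aeval_mem_towerField_succ r⟩)]
  · have h1 : aeval (T.t i) r ∈ T.polyComplement i l φ := T.mem_polyComplement_iff.2 ⟨r, hr, rfl⟩
    exact Submodule.mem_sup_right (S := T.properComplement i S) h1
  · exact mem_summableSpace.2 ⟨g, hg, (sub_eq_of_eq_add hf).symm⟩

end ReductionStep

section Reduction

variable {ι : Type w} (b : Module.Basis ι T.C F₀) (φ₀ : F₀ →ₗ[T.C] F₀) (S : ℕ → Set L)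
  (θ : (i : ℕ) → T.fieldSpace i)

/-- Allows the `θ_i` to be chosen one after another: a later choice leaves earlier reductions
unchanged. -/
lemma reduction_congr (Θ₀ : Set F₀) {θ θ' : (i : ℕ) → T.fieldSpace i} {i : ℕ}
    (h : ∀ j < i, θ j = θ' j) : T.reduction Θ₀ φ₀ S θ i = T.reduction Θ₀ φ₀ S θ' i := by
  induction i with
  | zero => rfl
  | succ i ih =>
    rw [reduction, reduction, ih fun j hj => h j (Nat.lt_succ_of_lt hj), h i (Nat.lt_succ_self i)]

/-- The condition on `θ_{i+1}` in `IsSecondPairs`. -/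
def IsSecondPairAt (Θ₀ : Set F₀) (i : ℕ) (hi : i < n) : Prop :=
  (θ i : L) ∈ T.canonicalBasis Θ₀ i ∧
    T.canonicalCoord Θ₀ i (θ i) (T.reduction Θ₀ φ₀ S θ i (T.diffGen i hi)) ≠ 0 ∧
    T.indicator (θ i) = T.indicator (T.reduction Θ₀ φ₀ S θ i (T.diffGen i hi))

lemma isCompleteReduction_reduction_zero (Θ₀ : Set F₀)
    (hφ₀ : IsCompleteReduction (LinearMap.range (groundDiff T.σ₀)) φ₀) :
    IsCompleteReduction (summableSpace T.Δ (T.fieldSpace 0)) (T.reduction Θ₀ φ₀ S θ 0) := by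
  have hΔ : ∀ a : F₀, T.Δ (T.baseEquiv a : L) = (T.baseEquiv (groundDiff T.σ₀ a) : L) := by
    intro a
    change T.σ (algebraMap F₀ L a) - algebraMap F₀ L a = algebraMap F₀ L (T.σ₀ a - a)
    rw [T.σ_algebraMap, map_sub]
  have hmem : ∀ a : F₀, T.baseEquiv a ∈ summableSpace T.Δ (T.fieldSpace 0) ↔
      a ∈ LinearMap.range (groundDiff T.σ₀) := by
    intro a
    rw [mem_summableSpace]
    constructor
    · rintro ⟨g, hg, hga⟩
      obtain ⟨c, hc⟩ := T.baseEquiv.surjective ⟨g, hg⟩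
      refine ⟨c, T.baseEquiv.injective (Subtype.ext ?_)⟩
      rw [← hΔ, hc, ← hga]
    · rintro ⟨c, rfl⟩
      exact ⟨T.baseEquiv c, (T.baseEquiv c).2, hΔ c⟩
  constructor
  · intro f
    obtain ⟨a, rfl⟩ := T.baseEquiv.surjective f
    rw [reduction, LinearEquiv.conj_apply_apply, LinearEquiv.symm_apply_apply, ← map_sub, hmem]
    exact hφ₀.sub_mem a
  · ext f
    obtain ⟨a, rfl⟩ := T.baseEquiv.surjective f
    rw [LinearMap.mem_ker, reduction, LinearEquiv.conj_apply_apply, LinearEquiv.symm_apply_apply,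
      hmem, LinearEquiv.map_eq_zero_iff, hφ₀.apply_eq_zero_iff]

section

variable [CharZero F₀] {b φ₀ S θ}
  (hφ₀ : IsCompleteReduction (LinearMap.range (groundDiff T.σ₀)) φ₀)
  (hS : ∀ i < n, T.IsRepresentatives i (S i))
include hφ₀ hS

lemma isCompleteReduction_reduction {i : ℕ} (hi : i ≤ n)
    (hθ : ∀ (j : ℕ) (hj : j < n), j < i → T.IsSecondPairAt φ₀ S θ (Set.range b) j hj) :
    IsCompleteReduction (summableSpace T.Δ (T.fieldSpace i))
      (T.reduction (Set.range b) φ₀ S θ i) := by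
  induction i with
  | zero => exact T.isCompleteReduction_reduction_zero φ₀ S θ _ hφ₀
  | succ i ih =>
    have h1 := ih (Nat.le_of_succ_le hi) fun j hj hji => hθ j hj (Nat.lt_succ_of_lt hji)
    exact T.isCompleteReduction_reductionStep
      (T.isCompl_complement hi (hS i hi) h1 (hθ i hi (Nat.lt_succ_self i)).2.1)

lemma isCompl_complement_reduction {i : ℕ} (hi : i < n)
    (hθ : T.IsSecondPairs (Set.range b) φ₀ S θ) :
    IsCompl (T.complement i (S i) (T.canonicalCoord (Set.range b) i (θ i))
      (T.reduction (Set.range b) φ₀ S θ i)) (summableSpace T.Δ (T.fieldSpace (i + 1))) :=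
  T.isCompl_complement hi (hS i hi)
    (T.isCompleteReduction_reduction hφ₀ hS hi.le fun j hj _ => hθ j hj) (hθ i hi).2.1

omit hφ₀ hS [CharZero F₀] in
-- If `Δ t = Δ g` with `g ∈ F_i`, then `t - g` is a constant, so `t ∈ F_i`, against transcendence.
lemma diffGen_not_mem_summableSpace {i : ℕ} (hi : i < n) :
    T.diffGen i hi ∉ summableSpace T.Δ (T.fieldSpace i) := by
  intro hmem
  obtain ⟨g, hg, hgt⟩ := mem_summableSpace.1 hmem
  have h1 : T.Δ g = T.Δ (T.t i) := hgt
  rw [Δ_apply, Δ_apply] at h1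
  obtain ⟨c, hc⟩ := T.const_eq (T.t i - g) (by
    rw [map_sub]
    linear_combination -h1)
  have ht : T.t i ∈ towerField F₀ T.t i := by
    have := add_mem (IntermediateField.algebraMap_mem (towerField F₀ T.t i) c) hg
    rwa [hc, sub_add_cancel] at this
  exact T.transcendental i hi
    (isAlgebraic_algebraMap (⟨T.t i, ht⟩ : towerField F₀ T.t i))

/-- As `Δ(t)` is not summable, its reduction is nonzero and has an effective basis element of the
same indicator; the sequence is updated at one index at a time. -/
lemma exists_isSecondPairs :
    ∃ θ : (i : ℕ) → T.fieldSpace i, T.IsSecondPairs (Set.range b) φ₀ S θ := by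
  suffices ∀ k ≤ n, ∃ θ : (i : ℕ) → T.fieldSpace i, ∀ (j : ℕ) (hj : j < n), j < k →
      T.IsSecondPairAt φ₀ S θ (Set.range b) j hj by
    obtain ⟨θ, hθ⟩ := this n le_rfl
    exact ⟨θ, fun j hj => hθ j hj hj⟩
  intro k
  induction k with
  | zero => exact fun _ => ⟨fun _ => 0, fun j _ hj => absurd hj (Nat.not_lt_zero j)⟩
  | succ k ih =>
    intro hk
    obtain ⟨θ, hθ⟩ := ih (Nat.le_of_succ_le hk)
    have hred := T.isCompleteReduction_reduction hφ₀ hS (Nat.le_of_succ_le hk) hθ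
    obtain ⟨ξ, hξ⟩ := T.exists_canonicalCoord_ne_zero b (Nat.le_of_succ_le hk)
      (f := T.reduction (Set.range b) φ₀ S θ k (T.diffGen k hk))
      (fun h0 => T.diffGen_not_mem_summableSpace hk (hred.apply_eq_zero_iff.1 h0))
    have hcongr : ∀ j ≤ k, T.reduction (Set.range b) φ₀ S (Function.update θ k ξ) j =
        T.reduction (Set.range b) φ₀ S θ j := fun j hj =>
      T.reduction_congr φ₀ S _ fun m hm => Function.update_of_ne (by omega) _ _
    refine ⟨Function.update θ k ξ, fun j hj hjk => ?_⟩
    rw [IsSecondPairAt, hcongr j (Nat.le_of_lt_succ hjk)]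
    rcases Nat.lt_succ_iff_lt_or_eq.1 hjk with h | rfl
    · rw [Function.update_of_ne (by omega)]
      exact hθ j hj h
    · rw [Function.update_self]
      exact hξ

/-! ### The polynomial rings of the tower -/

variable (hT : T.IsRingTower) (hθ : T.IsSecondPairs (Set.range b) φ₀ S θ)
include hT hθ

/-- The polynomial reduction with `A = E_i`. The polynomial `r` is exposed, with its coefficients in
both `E_i` and `im φ_i ∩ ker θ^*`, because this is exactly what the search in the algorithm must
find. -/
lemma reduction_ring_succ {i : ℕ} (hi : i < n)
    (ih : ∀ f : T.fieldSpace i, (f : L) ∈ towerRing F₀ T.t i →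
      (T.reduction (Set.range b) φ₀ S θ i f : L) ∈ towerRing F₀ T.t i ∧
        ∃ g ∈ T.fieldSpace i, g ∈ towerRing F₀ T.t i ∧
          T.Δ g = f - T.reduction (Set.range b) φ₀ S θ i f)
    (f : T.fieldSpace (i + 1)) (hf : (f : L) ∈ towerRing F₀ T.t (i + 1)) :
    ∃ g ∈ towerRing F₀ T.t (i + 1), ∃ r : (towerField F₀ T.t i)[X],
      (∀ k, (r.coeff k : L) ∈ towerRing F₀ T.t i) ∧
      (∀ k, r.coeff k ∈ T.stepGroup i (T.canonicalCoord (Set.range b) i (θ i))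
        (T.reduction (Set.range b) φ₀ S θ i)) ∧
      (T.reduction (Set.range b) φ₀ S θ (i + 1) f : L) = aeval (T.t i) r ∧
      (f : L) = T.Δ g + aeval (T.t i) r := by
  obtain ⟨p, hp, hpf⟩ := T.mem_towerRing_succ.1 hf
  obtain ⟨g, r, hg, hr, hrW, heq⟩ := T.exists_poly_reduction hi (hθ i hi).2.1
    (A := towerRing F₀ T.t i) (fun x hx => T.σ_mem_towerRing hT hi.le hx) (hT i hi) ih p hp
  rw [hpf] at heq
  exact ⟨aeval (T.t i) g, T.mem_towerRing_succ.2 ⟨g, hg, rfl⟩, r, hr, hrW,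
    T.coe_reductionStep_eq_aeval (T.isCompl_complement_reduction hφ₀ hS hi hθ)
      (T.aeval_mem_towerField_succ g) hrW heq, heq⟩

lemma reduction_ring {i : ℕ} (hi : i ≤ n) (f : T.fieldSpace i)
    (hf : (f : L) ∈ towerRing F₀ T.t i) :
    (T.reduction (Set.range b) φ₀ S θ i f : L) ∈ towerRing F₀ T.t i ∧
      ∃ g ∈ T.fieldSpace i, g ∈ towerRing F₀ T.t i ∧
        T.Δ g = f - T.reduction (Set.range b) φ₀ S θ i f := by
  induction i with
  | zero =>
    have hle : ∀ x, x ∈ T.fieldSpace 0 → x ∈ towerRing F₀ T.t 0 := fun x hx => by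
      obtain ⟨a, rfl⟩ := (T.mem_fieldSpace_zero x).1 hx
      exact Subalgebra.algebraMap_mem _ a
    obtain ⟨g, hg, h⟩ := mem_summableSpace.1
      ((T.isCompleteReduction_reduction_zero φ₀ S θ (Set.range b) hφ₀).sub_mem f)
    exact ⟨hle _ (SetLike.coe_mem _), g, hg, hle g hg, h⟩
  | succ i ih =>
    obtain ⟨g, hg, r, hr, -, hred, heq⟩ :=
      T.reduction_ring_succ hφ₀ hS hT hθ hi (ih (Nat.le_of_succ_le hi)) f hf
    refine ⟨?_, g, T.towerRing_le_towerField _ hg, hg, ?_⟩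
    · rw [hred]
      exact T.mem_towerRing_succ.2 ⟨r, hr, rfl⟩
    · rw [hred, heq, add_sub_cancel_right]

/-- The restriction of `φ_i` to `E_i`. -/
lemma exists_ring_reduction {i : ℕ} (hi : i ≤ n) :
    ∃ ψ : T.ringSpace i →ₗ[T.C] T.ringSpace i,
      (∀ f : T.ringSpace i, (ψ f : L) = T.reduction (Set.range b) φ₀ S θ i
        (Submodule.inclusion (T.ringSpace_le_fieldSpace i) f)) ∧
      IsCompleteReduction
        (LinearMap.range (T.Δ.restrict fun _ hf => T.Δ_mem_ringSpace hT hi hf)) ψ := by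
  have hred := T.isCompleteReduction_reduction hφ₀ hS hi fun j hj _ => hθ j hj
  set φ := T.reduction (Set.range b) φ₀ S θ i with hφ
  have hring : ∀ f : T.ringSpace i, _ := fun f => T.reduction_ring hφ₀ hS hT hθ hi
    (Submodule.inclusion (T.ringSpace_le_fieldSpace i) f) f.2
  let ψ : T.ringSpace i →ₗ[T.C] T.ringSpace i := LinearMap.codRestrict (T.ringSpace i)
    ((T.fieldSpace i).subtype ∘ₗ φ ∘ₗ Submodule.inclusion (T.ringSpace_le_fieldSpace i))
    fun f => (hring f).1
  have hψ : ∀ f : T.ringSpace i,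
      (ψ f : L) = φ (Submodule.inclusion (T.ringSpace_le_fieldSpace i) f) := fun f => rfl
  have hsub : ∀ f, f - ψ f ∈
      LinearMap.range (T.Δ.restrict fun _ hf => T.Δ_mem_ringSpace hT hi hf) := fun f => by
    obtain ⟨-, g, -, hg, h⟩ := hring f
    exact ⟨⟨g, hg⟩, Subtype.ext h⟩
  refine ⟨ψ, hψ, hsub, ?_⟩
  ext f
  rw [LinearMap.mem_ker]
  constructor
  · intro h0
    have := hsub f
    rwa [h0, sub_zero] at this
  · rintro ⟨g, rfl⟩
    apply Subtype.ext
    rw [hψ, hred.apply_eq_zero_iff.2]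
    · rfl
    · exact mem_summableSpace.2 ⟨g, T.ringSpace_le_fieldSpace i g.2, rfl⟩

end

end Reduction

end SigmaTower

/-! ### Computable functions on lists and unbounded search -/

section Computability

variable {α β γ : Type*} [Primcodable α] [Primcodable β] [Primcodable γ]

/-- A right fold is a recursion on the length whose step `k` processes entry `k` of the reversed
list. -/
theorem Computable.list_foldr {f : α → List β} {g : α → γ} {h : α → β × γ → γ}
    (hf : Computable f) (hg : Computable g) (hh : Computable₂ h) :
    Computable fun a => (f a).foldr (fun b s => h a (b, s)) (g a) := by
  have hrec : Computable fun a => Nat.rec (motive := fun _ => γ) (g a)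
      (fun k s => Option.casesOn ((f a).reverse[k]?) s fun b => h a (b, s)) (f a).length := by
    refine Computable.nat_rec (f := fun a => (f a).length) (g := g)
      (h := fun a p => Option.casesOn ((f a).reverse[p.1]?) p.2 fun b => h a (b, p.2))
      (Computable.list_length.comp hf) hg ?_
    refine Computable.option_casesOn (o := fun p : α × (ℕ × γ) => (f p.1).reverse[p.2.1]?)
      (f := fun p => p.2.2) (g := fun p b => h p.1 (b, p.2.2)) ?_ ?_ ?_
    · exact Computable.list_getElem?.comp
        (Computable.list_reverse.comp (hf.comp Computable.fst))
        (Computable.fst.comp Computable.snd)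
    · exact Computable.snd.comp Computable.snd
    · exact hh.comp (Computable.fst.comp Computable.fst)
        (Computable.pair Computable.snd
          (Computable.snd.comp (Computable.snd.comp Computable.fst)))
  refine hrec.of_eq fun a => ?_
  generalize f a = l
  induction l with
  | nil => rfl
  | cons b l ih =>
    rw [List.foldr_cons, ← ih]
    -- The new head comes last after reversal, so the first `l.length` steps do not see it.
    have key : ∀ k ≤ l.length, (Nat.rec (motive := fun _ => γ) (g a)
        (fun k s => Option.casesOn ((b :: l).reverse[k]?) s fun b => h a (b, s)) k) =
        Nat.rec (motive := fun _ => γ) (g a)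
        (fun k s => Option.casesOn (l.reverse[k]?) s fun b => h a (b, s)) k := by
      intro k hk
      induction k with
      | zero => rfl
      | succ k ihk =>
        simp only
        rw [ihk (Nat.le_of_succ_le hk), List.reverse_cons, List.getElem?_append_left (by simpa)]
    rw [List.length_cons]
    simp only
    rw [key _ le_rfl, List.reverse_cons]
    simp

theorem Computable.list_map' {f : β → γ} (hf : Computable f) :
    Computable fun l : List β => l.map f := by
  refine (Computable.list_foldr (f := fun l : List β => l) (g := fun _ => ([] : List γ))
    (h := fun _ p => f p.1 :: p.2) Computable.id (Computable.const _)
    (Computable.list_cons.comp (hf.comp (Computable.fst.comp Computable.snd))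
      (Computable.snd.comp Computable.snd))).of_eq fun l => ?_
  induction l with
  | nil => rfl
  | cons b l ih => rw [List.foldr_cons, ih, List.map_cons]

theorem Computable.band {f g : α → Bool} (hf : Computable f) (hg : Computable g) :
    Computable fun a => f a && g a :=
  (Primrec.and.to_comp).comp hf hg

theorem Computable.list_all {f : β → Bool} (hf : Computable f) :
    Computable fun l : List β => l.all f := by
  refine (Computable.list_foldr (f := fun l : List β => l) (g := fun _ => true)
    (h := fun _ p => f p.1 && p.2) Computable.id (Computable.const _)
    (Computable.band (hf.comp (Computable.fst.comp Computable.snd))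
      (Computable.snd.comp Computable.snd))).of_eq fun l => ?_
  induction l with
  | nil => rfl
  | cons b l ih => rw [List.foldr_cons, ih, List.all_cons]

theorem Computable.list_getD (z : β) :
    Computable₂ fun (l : List β) (k : ℕ) => l.getD k z :=
  (Computable.option_getD Computable.list_getElem? (Computable.const z)).of_eq fun p => by
    simp only [List.getD_eq_getElem?_getD]

/-- Unbounded search. -/
theorem exists_computable_of_forall_exists {P : α → β → Bool} (hP : Computable₂ P)
    (h : ∀ a, ∃ b, P a b = true) : ∃ f : α → β, Computable f ∧ ∀ a, P a (f a) = true := by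
  let F : α → ℕ → Option β := fun a k =>
    (Encodable.decode k : Option β).bind fun b => cond (P a b) (some b) none
  have hF : Computable₂ F := by
    refine Computable.option_bind (f := fun p : α × ℕ => (Encodable.decode p.2 : Option β))
      (g := fun p b => cond (P p.1 b) (some b) none)
      (Computable.decode.comp Computable.snd) ?_
    exact Computable.cond (hP.comp (Computable.fst.comp Computable.fst) Computable.snd)
      (Computable.option_some.comp Computable.snd) (Computable.const none)
  have hdom : ∀ a, (Nat.rfindOpt (F a)).Dom := fun a => by
    obtain ⟨b, hb⟩ := h a
    refine Nat.rfindOpt_dom.2 ⟨Encodable.encode b, b, ?_⟩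
    simp [F, hb]
  refine ⟨fun a => (Nat.rfindOpt (F a)).get (hdom a),
    (Partrec.rfindOpt hF).of_eq_tot fun a => Part.get_mem _, fun a => ?_⟩
  obtain ⟨k, hk⟩ := Nat.rfindOpt_spec (Part.get_mem (hdom a))
  obtain ⟨b, -, hb⟩ := Option.bind_eq_some_iff.1 (Option.mem_def.1 hk)
  cases hPb : P a b with
  | false => simp [hPb] at hb
  | true =>
    rw [hPb] at hb
    have hb' := Option.some.inj hb
    change P a ((Nat.rfindOpt (F a)).get (hdom a)) = true
    rwa [← hb']

end Computability

/-! ### Codes of polynomials -/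

/-- The value at `t` of the polynomial with list of coefficients `l`, coded by `ev`. -/
def evalList {β L : Type*} [Field L] (ev : β → L) (t : L) (l : List β) : L :=
  l.foldr (fun c x => ev c + t * x) 0

/-- The coding `ev` makes addition, multiplication by a fixed element, `σ` and the zero test
computable. -/
structure IsComputableCoding {β L : Type*} [Primcodable β] [Field L] (σ : L ≃+* L) (ev : β → L) :
    Prop where
  zero : ∃ z, ev z = 0
  add : ∃ f : β → β → β, Computable₂ f ∧ ∀ a b, ev (f a b) = ev a + ev b
  neg : ∃ f : β → β, Computable f ∧ ∀ a, ev (f a) = -ev a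
  mul : ∀ e : β, ∃ f : β → β, Computable f ∧ ∀ a, ev (f a) = ev e * ev a
  shift : ∃ f : β → β, Computable f ∧ ∀ a, ev (f a) = σ (ev a)
  isZero : ∃ f : β → Bool, Computable f ∧ ∀ a, f a = true ↔ ev a = 0

section EvalList

variable {β L : Type*} [Field L] (ev : β → L) (t : L)

@[simp] lemma evalList_nil : evalList ev t [] = 0 := rfl

@[simp] lemma evalList_cons (c : β) (l : List β) :
    evalList ev t (c :: l) = ev c + t * evalList ev t l := rfl

lemma evalList_drop {z : β} (hz : ev z = 0) (l : List β) (m : ℕ) :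
    evalList ev t (l.drop m) = ev (l.getD m z) + t * evalList ev t (l.drop (m + 1)) := by
  rcases Nat.lt_or_ge m l.length with h | h
  · rw [List.drop_eq_getElem_cons h, evalList_cons, List.getD_eq_getElem _ _ h]
  · rw [List.drop_eq_nil_of_le h, List.drop_eq_nil_of_le (by omega), List.getD_eq_default _ _ h, hz]
    simp

lemma evalList_map {f : β → β} {e : L} (hf : ∀ a, ev (f a) = e * ev a) (l : List β) :
    evalList ev t (l.map f) = e * evalList ev t l := by
  induction l with
  | nil => simp
  | cons c l ih =>
    rw [List.map_cons, evalList_cons, evalList_cons, hf, ih]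
    ring

lemma evalList_eq_sum {z : β} (hz : ev z = 0) (l : List β) {N : ℕ} (hN : l.length ≤ N) :
    evalList ev t l = ∑ k ∈ Finset.range N, ev (l.getD k z) * t ^ k := by
  induction N generalizing l with
  | zero =>
    rw [List.length_eq_zero_iff.1 (Nat.le_zero.1 hN)]
    simp
  | succ N ih =>
    cases l with
    | nil => simp [hz]
    | cons c l =>
      rw [Finset.sum_range_succ', evalList_cons, ih l (by simpa using hN), Finset.mul_sum, add_comm]
      congr 1
      · refine Finset.sum_congr rfl fun k _ => ?_
        rw [List.getD_cons_succ]
        ring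
      · simp

variable {K : Type*} [Field K] [Algebra K L]

/-- The value of a list of coefficients in `W` is the value of a polynomial over `W`. -/
lemma exists_aeval_eq_evalList (W : AddSubgroup K) (l : List β)
    (h : ∀ c ∈ l, ∃ k ∈ W, algebraMap K L k = ev c) :
    ∃ p : K[X], (∀ k, p.coeff k ∈ W) ∧ aeval t p = evalList ev t l := by
  induction l with
  | nil => exact ⟨0, fun k => by simp [zero_mem], by simp⟩
  | cons c l ih =>
    obtain ⟨p, hp, hpl⟩ := ih fun d hd => h d (List.mem_cons_of_mem c hd)
    obtain ⟨k, hk, hkc⟩ := h c List.mem_cons_self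
    refine ⟨C k + X * p, fun m => ?_, by simp [hkc, hpl]⟩
    cases m with
    | zero => simpa using hk
    | succ m =>
      rw [coeff_add, coeff_C_succ, coeff_X_mul, zero_add]
      exact hp m

lemma evalList_eq_zero_iff (ht : Transcendental K t) (hev : ∀ c, ∃ k : K, algebraMap K L k = ev c)
    (l : List β) : evalList ev t l = 0 ↔ ∀ c ∈ l, ev c = 0 := by
  induction l with
  | nil => simp
  | cons c l ih =>
    obtain ⟨k, hk⟩ := hev c
    obtain ⟨p, -, hp⟩ := exists_aeval_eq_evalList ev t (⊤ : AddSubgroup K) l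
      fun d _ => (hev d).imp fun k hk => ⟨trivial, hk⟩
    rw [List.forall_mem_cons, ← ih, evalList_cons]
    constructor
    · intro h0
      have h1 : C k + X * p = 0 := transcendental_iff.1 ht _ (by simp [hk, hp, h0])
      have hk0 : k = 0 := by simpa using congrArg (fun q => coeff q 0) h1
      have hp0 : p = 0 := by
        rw [hk0, map_zero, zero_add] at h1
        exact (mul_eq_zero.1 h1).resolve_left X_ne_zero
      exact ⟨by rw [← hk, hk0, map_zero], by rw [← hp, hp0, map_zero]⟩
    · rintro ⟨h1, h2⟩
      rw [h1, h2]
      simp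

/-- The second clause transfers any property shared by all coefficients of `p` to the entries of the
code. -/
lemma exists_evalList_eq_aeval (p : K[X]) (h : ∀ k, ∃ c, ev c = algebraMap K L (p.coeff k)) :
    ∃ l : List β, evalList ev t l = aeval t p ∧ ∀ c ∈ l, ∃ k, ev c = algebraMap K L (p.coeff k) := by
  suffices ∀ (N : ℕ) (p : K[X]), p.natDegree < N →
      (∀ k, ∃ c, ev c = algebraMap K L (p.coeff k)) → ∃ l : List β, evalList ev t l = aeval t p ∧
        ∀ c ∈ l, ∃ k, ev c = algebraMap K L (p.coeff k) from this _ p (Nat.lt_succ_self _) h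
  intro N
  induction N with
  | zero => exact fun p hp => absurd hp (Nat.not_lt_zero _)
  | succ N ih =>
    intro p hp h
    by_cases hp0 : p = 0
    · exact ⟨[], by simp [hp0], by simp⟩
    have hdiv : ∀ k, p.divX.coeff k = p.coeff (k + 1) := fun k => coeff_divX
    obtain ⟨c, hc⟩ := h 0
    have heq : aeval t p = ev c + t * aeval t p.divX := by
      conv_lhs => rw [← X_mul_divX_add p]
      rw [map_add, map_mul, aeval_X, aeval_C, hc, add_comm]
    rcases Nat.eq_zero_or_pos p.natDegree with hd | hd
    · refine ⟨[c], ?_, fun d hd => ⟨0, by rw [List.mem_singleton.1 hd, hc]⟩⟩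
      rw [eq_C_of_natDegree_eq_zero hd, aeval_C]
      simp [hc]
    · obtain ⟨l, hl, hlc⟩ := ih p.divX (by rw [natDegree_divX_eq_natDegree_tsub_one]; omega)
        fun k => by rw [hdiv]; exact h (k + 1)
      refine ⟨c :: l, by rw [evalList_cons, hl, heq], ?_⟩
      rw [List.forall_mem_cons]
      refine ⟨⟨0, hc⟩, fun d hd => ?_⟩
      obtain ⟨k, hk⟩ := hlc d hd
      exact ⟨k + 1, by rw [hk, hdiv]⟩

end EvalList

namespace IsComputableCoding

variable {β L K : Type*} [Primcodable β] [Field L] [Field K] [Algebra K L] {σ : L ≃+* L}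
  {ev : β → L} (h : IsComputableCoding σ ev)
include h

lemma list_add (t : L) : ∃ f : List β → List β → List β, Computable₂ f ∧
    ∀ a b, evalList ev t (f a b) = evalList ev t a + evalList ev t b := by
  obtain ⟨z, hz⟩ := h.zero
  obtain ⟨add, hadd, hadd'⟩ := h.add
  -- Any common bound for the two lengths will do: missing entries are read as the code `z` of zero,
  -- and superfluous zeros do not change the value. After `j` steps `F` codes the sum of the tails
  -- from index `N - j`.
  let N : List β × List β → ℕ := fun p => p.1.length + p.2.length
  let F : List β × List β → ℕ → List β := fun p k => Nat.rec (motive := fun _ => List β) []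
    (fun j s => add (p.1.getD (N p - 1 - j) z) (p.2.getD (N p - 1 - j) z) :: s) k
  have hN : Computable N := Primrec.nat_add.to_comp.comp
    (Computable.list_length.comp Computable.fst) (Computable.list_length.comp Computable.snd)
  have hF : Computable fun p => F p (N p) := by
    refine Computable.nat_rec (f := N) (g := fun _ => [])
      (h := fun p q => add (p.1.getD (N p - 1 - q.1) z) (p.2.getD (N p - 1 - q.1) z) :: q.2)
      hN (Computable.const _) ?_
    have hidx : Computable fun x : (List β × List β) × (ℕ × List β) => N x.1 - 1 - x.2.1 :=
      Primrec.nat_sub.to_comp.comp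
        (Primrec.nat_sub.to_comp.comp (hN.comp Computable.fst) (Computable.const 1))
        (Computable.fst.comp Computable.snd)
    exact Computable.list_cons.comp
      (hadd.comp
        ((Computable.list_getD z).comp (Computable.fst.comp Computable.fst) hidx)
        ((Computable.list_getD z).comp (Computable.snd.comp Computable.fst) hidx))
      (Computable.snd.comp Computable.snd)
  refine ⟨fun a b => F (a, b) (N (a, b)), hF, fun a b => ?_⟩
  have key : ∀ j ≤ N (a, b), evalList ev t (F (a, b) j) =
      evalList ev t (a.drop (N (a, b) - j)) + evalList ev t (b.drop (N (a, b) - j)) := by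
    intro j hj
    induction j with
    | zero =>
      rw [List.drop_eq_nil_of_le (by simp [N]), List.drop_eq_nil_of_le (by simp [N])]
      simp [F]
    | succ j ih =>
      have h1 : F (a, b) (j + 1) = add (a.getD (N (a, b) - 1 - j) z) (b.getD (N (a, b) - 1 - j) z) ::
        F (a, b) j := rfl
      have h2 : N (a, b) - (j + 1) = N (a, b) - 1 - j := by omega
      have h3 : N (a, b) - j = N (a, b) - 1 - j + 1 := by omega
      rw [h1, evalList_cons, hadd', ih (Nat.le_of_succ_le hj), h2, h3,
        evalList_drop ev t hz a (N (a, b) - 1 - j), evalList_drop ev t hz b (N (a, b) - 1 - j)]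
      ring
  have := key _ le_rfl
  simpa using this

/-- Lists of coefficients form again a computable coding. -/
theorem list {t : L} (ht : Transcendental K t) (hev : ∀ c, ∃ k : K, algebraMap K L k = ev c)
    {a : β} (ha : σ t = t + ev a) : IsComputableCoding σ (evalList ev t) := by
  obtain ⟨z, hz⟩ := h.zero
  obtain ⟨add, hadd, hadd'⟩ := h.list_add t
  refine ⟨⟨[], rfl⟩, ⟨add, hadd, hadd'⟩, ?_, ?_, ?_, ?_⟩
  · obtain ⟨f, hf, hf'⟩ := h.neg
    refine ⟨fun l => l.map f, Computable.list_map' hf, fun l => ?_⟩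
    rw [evalList_map ev t (e := -1) (fun c => by rw [hf', neg_one_mul]), neg_one_mul]
  · intro e
    induction e with
    | nil => exact ⟨fun _ => [], Computable.const _, fun l => by simp⟩
    | cons c e ih =>
      obtain ⟨f, hf, hf'⟩ := ih
      obtain ⟨m, hm, hm'⟩ := h.mul c
      -- Recursion on the fixed factor: `(c + t e) l = c l + t (e l)`, where prepending `z`
      -- multiplies by `t`.
      refine ⟨fun l => add (l.map m) (z :: f l),
        hadd.comp (Computable.list_map' hm) (Computable.list_cons.comp (Computable.const z) hf),
        fun l => ?_⟩
      rw [hadd', evalList_map ev t hm', evalList_cons, evalList_cons, hz, hf']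
      ring
  · obtain ⟨s, hs, hs'⟩ := h.shift
    obtain ⟨m, hm, hm'⟩ := h.mul a
    -- Horner's scheme for `σ(c + t x) = σ c + (t + ev a) σ x`; only multiplication by the fixed
    -- element coded by `a` is required.
    refine ⟨fun l => l.foldr (fun c x => add [s c] (add (z :: x) (x.map m))) [], ?_, fun l => ?_⟩
    · refine Computable.list_foldr (f := fun l : List β => l) (g := fun _ => [])
        (h := fun _ p => add [s p.1] (add (z :: p.2) (p.2.map m))) Computable.id
        (Computable.const _) ?_
      have h2 : Computable fun p : List β × (β × List β) => p.2.2 :=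
        Computable.snd.comp Computable.snd
      exact hadd.comp
        (Computable.list_cons.comp (hs.comp (Computable.fst.comp Computable.snd))
          (Computable.const []))
        (hadd.comp (Computable.list_cons.comp (Computable.const z) h2)
          ((Computable.list_map' hm).comp h2))
    · induction l with
      | nil => simp
      | cons c l ih =>
        simp only at ih ⊢
        rw [List.foldr_cons, hadd', hadd', evalList_map ev t hm', evalList_cons, evalList_cons,
          evalList_cons, hz, hs', map_add, map_mul, ha, evalList_nil]
        linear_combination (t + ev a) * ih
  · obtain ⟨f, hf, hf'⟩ := h.isZero
    refine ⟨fun l => l.all f, Computable.list_all hf, fun l => ?_⟩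
    rw [List.all_eq_true, evalList_eq_zero_iff ev t ht hev]
    simp only [hf']

end IsComputableCoding

/-! ### Codes of `E_i` and the computation of coordinates -/

namespace SigmaTower

variable {F₀ : Type u} {L : Type v} [Field F₀] [Field L] [Algebra F₀ L] {n : ℕ}
  (T : SigmaTower F₀ L n)

/-- The element of `F_i` with a given code. -/
def fieldCoding (i : ℕ) (c : PolyCode F₀ i) : T.fieldSpace i :=
  ⟨T.evalCode i c, T.ringSpace_le_fieldSpace i (T.evalCode_mem i c)⟩

lemma exists_algebraMap_eq_evalCode (i : ℕ) (c : PolyCode F₀ i) :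
    ∃ k : towerField F₀ T.t i, algebraMap _ L k = T.evalCode i c :=
  ⟨⟨T.evalCode i c, T.ringSpace_le_fieldSpace i (T.evalCode_mem i c)⟩, rfl⟩

lemma exists_evalCode_eq {i : ℕ} {x : L} (hx : x ∈ towerRing F₀ T.t i) :
    ∃ c : PolyCode F₀ i, T.evalCode i c = x := by
  induction i generalizing x with
  | zero =>
    obtain ⟨a, rfl⟩ := (T.mem_fieldSpace_zero x).1 (T.towerRing_le_towerField 0 hx)
    exact ⟨a, rfl⟩
  | succ i ih =>
    obtain ⟨p, hp, rfl⟩ := T.mem_towerRing_succ.1 hx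
    obtain ⟨l, hl, -⟩ := exists_evalList_eq_aeval (T.evalCode i) (T.t i) p fun k => ih (hp k)
    exact ⟨l, hl⟩

lemma exists_computable_isZero {F : Type*} [Field F] [Primcodable F] :
    ∃ f : F → Bool, Computable f ∧ ∀ a, f a = true ↔ a = 0 := by
  classical
  exact ⟨fun a => decide (a = 0), (Primrec.eq.decide.comp Primrec.id (Primrec.const 0)).to_comp,
    fun a => decide_eq_true_iff⟩

/-- The ring tower condition provides a code for `Δ(t_{i+1})` in `E_i`; it is built into the program
for `σ` as a fixed datum. -/
theorem isComputableCoding [Primcodable F₀] (hT : T.IsRingTower) (hF : IsComputableDifferenceField F₀ T.σ₀) {i : ℕ}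
    (hi : i ≤ n) : IsComputableCoding T.σ (T.evalCode i) := by
  induction i with
  | zero =>
    obtain ⟨f, hf, hf'⟩ := exists_computable_isZero (F := F₀)
    have h : IsComputableCoding (β := F₀) T.σ (algebraMap F₀ L) := by
      refine ⟨⟨0, map_zero _⟩, ⟨_, hF.add, map_add _⟩, ⟨_, hF.neg, map_neg _⟩, fun e =>
        ⟨fun a => e * a, hF.mul.comp (Computable.const e) Computable.id, map_mul _ e⟩,
        ⟨_, hF.shift, fun a => (T.σ_algebraMap a).symm⟩,
        ⟨f, hf, fun a => (hf' a).trans (map_eq_zero_iff _ (algebraMap F₀ L).injective).symm⟩⟩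
    exact h
  | succ i ih =>
    obtain ⟨a, ha⟩ := T.exists_evalCode_eq (hT i hi)
    exact (ih (Nat.le_of_succ_le hi)).list (T.transcendental i hi)
      (T.exists_algebraMap_eq_evalCode i) (a := a) (by
        rw [ha, Δ_apply, add_sub_cancel])

section Coord

variable {ι : Type w} (b : Module.Basis ι T.C F₀)

lemma canonicalCoord_zero (k : ι) {θ : T.fieldSpace 0} (hθ : (θ : L) = algebraMap F₀ L (b k))
    (a : F₀) : T.canonicalCoord (Set.range b) 0 θ (T.baseEquiv a) = b.repr a k := by
  have hspec := T.canonicalCoord_spec b (Nat.zero_le n) (θ := θ) ⟨b k, ⟨k, rfl⟩, hθ.symm⟩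
  have : T.canonicalCoord (Set.range b) 0 θ ∘ₗ T.baseEquiv.toLinearMap = b.coord k := by
    refine b.ext fun m => ?_
    rw [LinearMap.comp_apply, Module.Basis.coord_apply, b.repr_self]
    by_cases hmk : m = k
    · subst hmk
      rw [Finsupp.single_eq_same, ← hspec.1]
      congr 1
      exact Subtype.ext hθ.symm
    · rw [Finsupp.single_eq_of_ne (Ne.symm hmk)]
      refine hspec.2 _ ⟨b m, ⟨m, rfl⟩, rfl⟩ fun h => hmk ?_
      exact b.injective ((algebraMap F₀ L).injective ((congrArg Subtype.val h).trans hθ))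
  exact LinearMap.congr_fun this a

/-- The product with an element of the canonical `F_i`-basis of `F_{i+1}`. -/
def mulStep (i : ℕ) (m : ℕ) : T.fieldSpace i →ₗ[T.C] T.fieldSpace (i + 1) where
  toFun c := ⟨c * T.t i ^ m, mul_mem (S := IntermediateField F₀ L)
    (T.towerField_mono (Nat.le_succ i) c.2) (pow_mem (T.gen_mem_towerField (Nat.lt_succ_self i)) m)⟩
  map_add' _ _ := Subtype.ext (add_mul _ _ _)
  map_smul' _ _ := Subtype.ext (smul_mul_assoc _ _ _)

open Classical in
-- Multiplication by `t^m` maps basis elements to basis elements, and the factorization of a basis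
-- element as a product `ξ η` is unique.
lemma canonicalCoord_mulStep {i : ℕ} (hi : i < n) {ξ : T.fieldSpace i} {η : L}
    (hξ : (ξ : L) ∈ T.canonicalBasis (Set.range b) i) (hη : η ∈ T.canonicalStep i)
    {θ : T.fieldSpace (i + 1)} (hθ : (θ : L) = ξ * η) (m : ℕ) :
    T.canonicalCoord (Set.range b) (i + 1) θ ∘ₗ T.mulStep i m =
      if η = T.t i ^ m then T.canonicalCoord (Set.range b) i ξ else 0 := by
  refine T.eq_of_eqOn_canonicalBasis b hi.le fun ξ' hξ' => ?_
  have hspec := T.canonicalCoord_spec b hi (θ := θ) ⟨ξ, hξ, η, hη, hθ⟩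
  have hspec' := T.canonicalCoord_spec b hi.le (θ := ξ) hξ
  have hm : T.t i ^ m ∈ T.canonicalStep i := Or.inl ⟨m, rfl⟩
  have hmem : (T.mulStep i m ξ' : L) ∈ T.canonicalBasis (Set.range b) (i + 1) :=
    ⟨ξ', hξ', _, hm, rfl⟩
  have hinj := (T.canonicalBasis_product _ hi (T.linearIndepOn_canonicalBasis b hi.le)).injective
  have hiff : T.mulStep i m ξ' = θ ↔ ξ' = ξ ∧ η = T.t i ^ m := by
    constructor
    · intro h
      have h1 : (ξ' : L) * T.t i ^ m = ξ * η := (congrArg Subtype.val h).trans hθ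
      have h2 := @hinj (⟨ξ', hξ'⟩, ⟨_, hm⟩) (⟨ξ, hξ⟩, ⟨η, hη⟩) h1
      rw [Prod.mk.injEq] at h2
      exact ⟨Subtype.ext (congrArg (fun z : T.canonicalBasis (Set.range b) i => (z : L)) h2.1),
        (congrArg (fun z : T.canonicalStep i => (z : L)) h2.2).symm⟩
    · rintro ⟨rfl, rfl⟩
      exact Subtype.ext hθ.symm
  rw [LinearMap.comp_apply]
  by_cases h1 : η = T.t i ^ m
  · rw [if_pos h1]
    by_cases h2 : ξ' = ξ
    · rw [hiff.2 ⟨h2, h1⟩, hspec.1, h2, hspec'.1]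
    · rw [hspec.2 _ hmem fun h => h2 (hiff.1 h).1, hspec'.2 _ hξ' h2]
  · rw [if_neg h1, hspec.2 _ hmem fun h => h1 (hiff.1 h).2, LinearMap.zero_apply]

/-- The coordinate functionals of the canonical basis are computable on the codes of `E_i`. -/
theorem exists_computable_canonicalCoord [Primcodable F₀] (hb : IsEffectiveBasis b) {i : ℕ} (hi : i ≤ n)
    {θ : T.fieldSpace i} (hθ : (θ : L) ∈ T.canonicalBasis (Set.range b) i) :
    ∃ f : PolyCode F₀ i → F₀, Computable f ∧
      ∀ c, f c = (T.canonicalCoord (Set.range b) i θ (T.fieldCoding i c) : F₀) := by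
  induction i with
  | zero =>
    obtain ⟨_, ⟨k, rfl⟩, hk⟩ := hθ
    obtain ⟨-, coeff, hcoeff, hcoeff'⟩ := hb
    have h : Computable fun a : F₀ => coeff (b k) a :=
      hcoeff.comp (Computable.const _) Computable.id
    refine ⟨fun a : F₀ => coeff (b k) a, h, fun a => ?_⟩
    exact (hcoeff' k a).trans (congrArg _ (T.canonicalCoord_zero b k hk.symm a).symm)
  | succ i ih =>
    obtain ⟨ξ, hξ, η, hη, hξη⟩ := hθ
    set ξ' : T.fieldSpace i := ⟨ξ, T.canonicalBasis_subset _ i hξ⟩ with hξ'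
    obtain ⟨f, hf, hf'⟩ := ih (Nat.le_of_succ_le hi) (θ := ξ') hξ
    obtain ⟨z, hz⟩ := T.exists_evalCode_eq (zero_mem (towerRing F₀ T.t i))
    have hcoord := fun m => T.canonicalCoord_mulStep b hi (ξ := ξ') hξ hη hξη m
    have hsum : ∀ l : List (PolyCode F₀ i), T.fieldCoding (i + 1) l =
        ∑ k ∈ Finset.range l.length, T.mulStep i k (T.fieldCoding i (l.getD k z)) := by
      intro l
      apply Subtype.ext
      rw [AddSubmonoidClass.coe_finsetSum]
      exact evalList_eq_sum (T.evalCode i) (T.t i) hz l le_rfl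
    have hval : ∀ l : List (PolyCode F₀ i),
        T.canonicalCoord (Set.range b) (i + 1) θ (T.fieldCoding (i + 1) l) =
        ∑ k ∈ Finset.range l.length, (T.canonicalCoord (Set.range b) (i + 1) θ ∘ₗ T.mulStep i k)
          (T.fieldCoding i (l.getD k z)) := by
      intro l
      rw [hsum, map_sum]
      rfl
    -- If `η = t^k`, the coordinate is that of the `k`-th coefficient, taken as zero beyond the end
    -- of the list. If `η` is not a power of `t`, the functional vanishes on all of `E_{i+1}`.
    by_cases hpow : ∃ k, η = T.t i ^ k
    · obtain ⟨k, hk⟩ := hpow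
      have hne : ∀ m, m ≠ k → η ≠ T.t i ^ m := by
        intro m hmk h
        have hX : (X ^ k : (towerField F₀ T.t i)[X]) = X ^ m :=
          (T.isSigmaMonomial i hi).aeval_injective (by simp [← hk, ← h])
        have := congrArg natDegree hX
        rw [natDegree_X_pow, natDegree_X_pow] at this
        exact hmk this.symm
      have h : Computable fun l : List (PolyCode F₀ i) => f (l.getD k z) :=
        hf.comp ((Computable.list_getD z).comp Computable.id (Computable.const k))
      refine ⟨fun l : List (PolyCode F₀ i) => f (l.getD k z), h,
        fun l : List (PolyCode F₀ i) => ?_⟩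
      change f (l.getD k z) = _
      rw [hval l, hf', Finset.sum_eq_single k]
      · rw [hcoord, if_pos hk]
      · intro m _ hm
        rw [hcoord, if_neg (hne m hm), LinearMap.zero_apply]
      · intro hkl
        rw [List.getD_eq_default _ _ (by simpa using hkl)]
        have : T.fieldCoding i z = 0 := Subtype.ext hz
        rw [this, map_zero]
    · refine ⟨fun _ => 0, Computable.const 0, fun l : List (PolyCode F₀ i) => ?_⟩
      rw [hval l, Finset.sum_eq_zero fun m _ => by
        rw [hcoord, if_neg fun h => hpow ⟨m, h⟩, LinearMap.zero_apply]]
      rfl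

end Coord

/-! ### The algorithm on `E_i` -/

section Algorithm

variable [Primcodable F₀] [CharZero F₀] {ι : Type w} {b : Module.Basis ι T.C F₀} {φ₀ : F₀ →ₗ[T.C] F₀}
  {S : ℕ → Set L} {θ : (i : ℕ) → T.fieldSpace i}
  (hφ₀ : IsCompleteReduction (LinearMap.range (groundDiff T.σ₀)) φ₀)
  (hS : ∀ i < n, T.IsRepresentatives i (S i))
  (hT : T.IsRingTower) (hθ : T.IsSecondPairs (Set.range b) φ₀ S θ)

include hφ₀ hS hT hθ in
-- At level `i + 1` the algorithm searches for a pair `(g, r)` satisfying a decidable certificate.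
-- `reduction_ring_succ` gives termination and `coe_reductionStep_eq_aeval` gives correctness.
theorem exists_computable_reduction (hF : IsComputableDifferenceField F₀ T.σ₀)
    (hb : IsEffectiveBasis b) (hA : IsPhiComputable (id : F₀ → F₀) (groundDiff T.σ₀) φ₀)
    {i : ℕ} (hi : i ≤ n) :
    ∃ A : PolyCode F₀ i → PolyCode F₀ i × PolyCode F₀ i, Computable A ∧ ∀ c,
      T.evalCode i (A c).2 = T.reduction (Set.range b) φ₀ S θ i (T.fieldCoding i c) ∧
      T.evalCode i c = T.Δ (T.evalCode i (A c).1) + T.evalCode i (A c).2 := by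
  induction i with
  | zero =>
    obtain ⟨-, A, hA, hA'⟩ := hA
    refine ⟨A, hA, fun a : F₀ => ⟨?_, ?_⟩⟩
    · have h1 : T.fieldCoding 0 a = T.baseEquiv a := rfl
      rw [h1, reduction, LinearEquiv.conj_apply_apply, LinearEquiv.symm_apply_apply]
      exact congrArg (algebraMap F₀ L) (hA' a).1
    · have h1 := congrArg (algebraMap F₀ L) (hA' a).2
      rw [map_add] at h1
      refine h1.trans (congrArg (· + _) ?_)
      change algebraMap F₀ L (T.σ₀ (A a).1 - (A a).1) =
        T.σ (algebraMap F₀ L (A a).1) - algebraMap F₀ L (A a).1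
      rw [T.σ_algebraMap, map_sub]
  | succ i ih =>
    obtain ⟨A, hA, hA'⟩ := ih (Nat.le_of_succ_le hi)
    obtain ⟨co, hco, hco'⟩ :=
      T.exists_computable_canonicalCoord b hb (Nat.le_of_succ_le hi) (hθ i hi).1
    have hcod := T.isComputableCoding hT hF (Nat.le_of_succ_le hi)
    have hcod' := T.isComputableCoding hT hF hi
    obtain ⟨add, hadd, hadd'⟩ := hcod.add
    obtain ⟨neg, hneg, hneg'⟩ := hcod.neg
    obtain ⟨isZ, hisZ, hisZ'⟩ := hcod.isZero
    obtain ⟨Add, hAdd, hAdd'⟩ := hcod'.add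
    obtain ⟨Neg, hNeg, hNeg'⟩ := hcod'.neg
    obtain ⟨Sh, hSh, hSh'⟩ := hcod'.shift
    obtain ⟨IsZ, hIsZ, hIsZ'⟩ := hcod'.isZero
    obtain ⟨isZ₀, hisZ₀, hisZ₀'⟩ := exists_computable_isZero (F := F₀)
    set φ := T.reduction (Set.range b) φ₀ S θ i with hφ
    set l := T.canonicalCoord (Set.range b) i (θ i) with hl
    -- Decides membership in `im φ ∩ ker l`: since `φ` is idempotent, its image consists of the `c`
    -- with `φ c = c`.
    let good : PolyCode F₀ i → Bool := fun c => isZ (add (A c).2 (neg c)) && isZ₀ (co c)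
    have hgood : Computable good := Computable.band
      (hisZ.comp (hadd.comp (Computable.snd.comp hA) hneg)) (hisZ₀.comp hco)
    have hgood' : ∀ c, good c = true ↔ (φ (T.fieldCoding i c) : L) = T.evalCode i c ∧
        l (T.fieldCoding i c) = 0 := by
      intro c
      rw [Bool.and_eq_true, hisZ', hadd', hneg', (hA' c).1, ← sub_eq_add_neg, sub_eq_zero,
        hisZ₀', hco',
        ZeroMemClass.coe_eq_zero]
    let test : PolyCode F₀ (i + 1) → PolyCode F₀ (i + 1) × PolyCode F₀ (i + 1) → Bool := fun c p =>
      IsZ (Add (Add (Sh p.1) (Neg p.1)) (Add p.2 (Neg c))) &&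
        List.all (α := PolyCode F₀ i) p.2 good
    have hall : Computable fun p : PolyCode F₀ (i + 1) =>
      List.all (α := PolyCode F₀ i) p good := Computable.list_all hgood
    have htest : Computable₂ test := by
      have h1 : Computable fun x : PolyCode F₀ (i + 1) × (PolyCode F₀ (i + 1) × PolyCode F₀ (i + 1)) =>
          x.2.1 := Computable.fst.comp Computable.snd
      have h2 : Computable fun x : PolyCode F₀ (i + 1) × (PolyCode F₀ (i + 1) × PolyCode F₀ (i + 1)) =>
          x.2.2 := Computable.snd.comp Computable.snd
      exact Computable.band
        (hIsZ.comp (hAdd.comp (hAdd.comp (hSh.comp h1) (hNeg.comp h1))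
          (hAdd.comp h2 (hNeg.comp Computable.fst))))
        (hall.comp h2)
    have htest' : ∀ c p, test c p = true ↔
        T.evalCode (i + 1) c = T.Δ (T.evalCode (i + 1) p.1) + T.evalCode (i + 1) p.2 ∧
          List.all (α := PolyCode F₀ i) p.2 good = true := by
      intro c p
      rw [Bool.and_eq_true, hIsZ', hAdd', hAdd', hAdd', hSh', hNeg', hNeg', Δ_apply]
      refine and_congr ⟨fun h => ?_, fun h => ?_⟩ Iff.rfl
      · linear_combination -h
      · linear_combination -h
    obtain ⟨B, hB, hB'⟩ := exists_computable_of_forall_exists htest (fun c => by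
      obtain ⟨g, hg, r, hr, hrW, -, heq⟩ := T.reduction_ring_succ hφ₀ hS hT hθ hi
        (T.reduction_ring hφ₀ hS hT hθ (Nat.le_of_succ_le hi)) (T.fieldCoding (i + 1) c)
        (T.evalCode_mem (i + 1) c)
      obtain ⟨gc, hgc⟩ := T.exists_evalCode_eq hg
      obtain ⟨rc, hrc, hrc'⟩ := exists_evalList_eq_aeval (T.evalCode i) (T.t i) r
        fun k => T.exists_evalCode_eq (hr k)
      refine ⟨(gc, rc), (htest' _ _).2 ⟨?_, (List.all_eq_true (l := rc)).2
        fun d hd => (hgood' d).2 ?_⟩⟩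
      · rw [hgc]
        exact heq.trans (congrArg _ hrc.symm)
      · obtain ⟨k, hk⟩ := hrc' d hd
        obtain ⟨y, ⟨⟨x, hx⟩, hy⟩, hyk⟩ := hrW k
        have hdy : T.fieldCoding i d = y := Subtype.ext (hk.trans hyk.symm)
        have hred := T.isCompleteReduction_reduction hφ₀ hS (Nat.le_of_succ_le hi)
          fun j hj _ => hθ j hj
        rw [hdy]
        refine ⟨?_, hy⟩
        rw [← hx, hred.apply_apply, hx, hyk]
        exact hk.symm)
    refine ⟨B, hB, fun c => ?_⟩
    obtain ⟨h1, h2⟩ := (htest' _ _).1 (hB' c)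
    obtain ⟨r, hr, hr'⟩ := exists_aeval_eq_evalList (T.evalCode i) (T.t i) (T.stepGroup i l φ)
      ((B c).2 : List (PolyCode F₀ i)) fun d hd => by
        obtain ⟨hd1, hd2⟩ := (hgood' d).1 ((List.all_eq_true (l := (B c).2)).1 h2 d hd)
        exact ⟨⟨T.evalCode i d, T.ringSpace_le_fieldSpace i (T.evalCode_mem i d)⟩,
          ⟨T.fieldCoding i d, ⟨⟨T.fieldCoding i d, Subtype.ext hd1⟩, hd2⟩, rfl⟩, rfl⟩
    refine ⟨?_, h1⟩
    have h3 := T.coe_reductionStep_eq_aeval (T.isCompl_complement_reduction hφ₀ hS hi hθ)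
      (f := T.fieldCoding (i + 1) c) (g := T.evalCode (i + 1) (B c).1)
      (T.ringSpace_le_fieldSpace _ (T.evalCode_mem _ _)) hr
      (h1.trans (congrArg _ hr'.symm))
    exact hr'.symm.trans h3.symm

end Algorithm

end SigmaTower

end

/-! ### The main theorem -/

theorem mainTheorem12 {F₀ : Type u} {L : Type v} [Field F₀] [CharZero F₀] [Field L] [Algebra F₀ L]
    {n : ℕ} (T : SigmaTower F₀ L n) (hT : T.IsRingTower)
    {ι : Type w} (b : Module.Basis ι T.C F₀)
    (φ₀ : F₀ →ₗ[T.C] F₀) (hφ₀ : IsCompleteReduction (LinearMap.range (groundDiff T.σ₀)) φ₀)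
    (S : ℕ → Set L) (hS : ∀ i < n, T.IsRepresentatives i (S i)) :
    (∃ θ : (i : ℕ) → T.fieldSpace i, T.IsSecondPairs (Set.range b) φ₀ S θ) ∧
    ∀ θ : (i : ℕ) → T.fieldSpace i, T.IsSecondPairs (Set.range b) φ₀ S θ →
      (∀ i < n, IsCompl
        (T.complement i (S i) (T.canonicalCoord (Set.range b) i (θ i))
          (T.reduction (Set.range b) φ₀ S θ i))
        (summableSpace T.Δ (T.fieldSpace (i + 1)))) ∧
      ∀ i ≤ n,
        (T.fieldSpace i).map T.Δ ≤ T.fieldSpace i ∧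
        IsCompleteReduction (summableSpace T.Δ (T.fieldSpace i))
          (T.reduction (Set.range b) φ₀ S θ i) ∧
        ∃ (hΔ : ∀ f ∈ T.ringSpace i, T.Δ f ∈ T.ringSpace i)
          (ψ : T.ringSpace i →ₗ[T.C] T.ringSpace i),
          (∀ f : T.ringSpace i, (ψ f : L) =
            T.reduction (Set.range b) φ₀ S θ i
              (Submodule.inclusion (T.ringSpace_le_fieldSpace i) f)) ∧
          IsCompleteReduction (LinearMap.range (T.Δ.restrict hΔ)) ψ ∧
          ∀ [Primcodable F₀], IsComputableDifferenceField F₀ T.σ₀ → IsEffectiveBasis b →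
            IsPhiComputable (id : F₀ → F₀) (groundDiff T.σ₀) φ₀ →
            IsPhiComputable (T.ringCoding i) (T.Δ.restrict hΔ) ψ := by
  refine ⟨T.exists_isSecondPairs hφ₀ hS, fun θ hθ => ⟨fun i hi =>
    T.isCompl_complement_reduction hφ₀ hS hi hθ, fun i hi => ⟨?_, ?_, ?_⟩⟩⟩
  · rintro _ ⟨x, hx, rfl⟩
    exact T.Δ_mem_fieldSpace hi hx
  · exact T.isCompleteReduction_reduction hφ₀ hS hi fun j hj _ => hθ j hj
  · obtain ⟨ψ, hψ, hcr⟩ := T.exists_ring_reduction hφ₀ hS hT hθ hi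
    refine ⟨fun _ hf => T.Δ_mem_ringSpace hT hi hf, ψ, hψ, hcr, fun hF hb hA => ⟨?_, ?_⟩⟩
    · rintro ⟨x, hx⟩
      obtain ⟨c, hc⟩ := T.exists_evalCode_eq hx
      exact ⟨c, Subtype.ext hc⟩
    · obtain ⟨A, hA, hA'⟩ := T.exists_computable_reduction hφ₀ hS hT hθ hF hb hA hi
      exact ⟨A, hA, fun c => ⟨Subtype.ext ((hA' c).1.trans (hψ (T.ringCoding i c)).symm), Subtype.ext (hA' c).2⟩⟩
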